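/- **Setting.** Let $N,d\in\mathbb N$. Consider a game with $N$ players, action sets $A_i\subset\mathbb R^d$, joint action set $A=A_1\times\dots\times A_N\subset\mathbb R^{Nd}$, and cost functions $J_i:\mathbb R^{Nd}\to\mathbb R$, $i=1,\dots,N$. For $x\in\mathbb R^{Nd}$ write $x=(x^i,x^{-i})$ with $x^i\in\mathbb R^d$ the block of player $i$; $\|\cdot\|$ is the Euclidean norm. A point $a^*\in A$ is a Nash equilibrium if $J_i(a^{*i},a^{*-i})\le J_i(y,a^{*-i})$ for all $i$ and all $y\in A_i$. The pseudo-gradient is $M:\mathbb R^{Nd}\to\mathbb R^{Nd}$, $M(x)=(\nabla_{x^i}J_i(x^i,x^{-i}))_{i=1}^N$. Assume: 1. each $A_i$ is convex and closed; each $J_i$ is continuously differentiable on $\mathbb R^{Nd}$ and convex in $x^i$ for every fixed $x^{-i}$; 2. each $A_i$ is compact, and $0$ is an interior point of each $A_i$; 3. $M$ is strongly monotone on $\mathbb R^{Nd}$ with a constant $\nu>0$: $\langle M(x)-M(y),x-y\rangle\ge\nu\|x-y\|^2$ for all $x,y$; 4. for each $i$ there is $\alpha<2$ with $J_i(x)=O(\exp(\|x\|^{\alpha}))$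 as $\|x\|\to\infty$; 5. $M$ is twice differentiable on $\mathbb R^{Nd}$, or $M$ is differentiable and (globally) Lipschitz continuous on $\mathbb R^{Nd}$. **Algorithm (one-point estimates).** Start from an arbitrary deterministic $\mu(1)\in\mathbb R^{Nd}$. For $t=1,2,\dots$: given the past $\mu(1),\dots,\mu(t),\xi(1),\dots,\xi(t-1)$, the players independently sample $\xi^i(t)\sim\mathcal N(\mu^i(t),\sigma_t^2 I_d)$; they play $a^i(t)=\mathrm{Proj}_{A_i}[\xi^i(t)]$ and observe $J_i(a(t))$; they set $$m^i(t)=J_i(a(t))\,\frac{\xi^i(t)-\mu^i(t)}{\sigma_t^2},\qquad \mu^i(t+1)=\mathrm{Proj}_{(1-\rho_t)A_i}\big[\mu^i(t)-\gamma_t m^i(t)\big].$$ **Theorem.** Let $\gamma_t=\frac{4}{\nu t}$, $\sigma_t=\frac{a}{t^{1/4}}$ and $\rho_t=\frac{1}{t^{1/4-\varepsilon}}$ with $a>0$ and $0<\varepsilon<\frac14$. Under the assumptions above the game has a unique Nash equilibrium $a^*$, the state $\mu(t)$ converges to $a^*$ almost surely, the sample $\xi(t)$ converges to $a^*$ in probability,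 and $$\mathrm E\|\mu(t)-a^*\|^2=O\!\left(\frac{1}{t^{1/2-2\varepsilon}}\right)\quad\text{as }t\to\infty .$$ -/

import Mathlib

open MeasureTheory ProbabilityTheory Filter Topology
open scoped Pointwise

noncomputable section

namespace PayoffLearning

/-- The action space `ℝ^d` of one player, with the Euclidean norm. -/
abbrev Action (d : ℕ) : Type := EuclideanSpace ℝ (Fin d)

/-- The space `ℝ^{Nd}` of joint actions, with the Euclidean norm; `x i` is the block of player `i`. -/
abbrev Joint (N d : ℕ) : Type := PiLp 2 (fun _ : Fin N => Action d)

/-- The joint action `(y, x^{-i})`: player `i` plays `y`, all the others play as in `x`. -/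
def deviate {N d : ℕ} (x : Joint N d) (i : Fin N) (y : Action d) : Joint N d :=
  WithLp.toLp 2 (Function.update (fun j => x j) i y)

/-- `a` is a Nash equilibrium of the game with action sets `A i` and costs `J i`. -/
def IsNash {N d : ℕ} (A : Fin N → Set (Action d)) (J : Fin N → Joint N d → ℝ)
    (a : Joint N d) : Prop :=
  (∀ i, a i ∈ A i) ∧ ∀ i, ∀ y ∈ A i, J i a ≤ J i (deviate a i y)

/-- The pseudo-gradient: its block `i` is the gradient of `J i` in the action of player `i`. -/
def pseudoGradient {N d : ℕ} (J : Fin N → Joint N d → ℝ) (x : Joint N d) : Joint N d :=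
  WithLp.toLp 2 (fun i => gradient (fun y : Action d => J i (deviate x i y)) (x i))

/-- `F` is strongly monotone on the whole space with constant `ν`. -/
def StronglyMonotone {N d : ℕ} (ν : ℝ) (F : Joint N d → Joint N d) : Prop :=
  ∀ x y, ν * ‖x - y‖ ^ 2 ≤ inner ℝ (F x - F y) (x - y)

/-- `p` is a Euclidean projection of `x` on `S`. -/
def IsProj {d : ℕ} (S : Set (Action d)) (x p : Action d) : Prop :=
  p ∈ S ∧ ∀ q ∈ S, ‖x - p‖ ≤ ‖x - q‖

/-- The information available just before the sampling at time `t`: the σ-algebra generated by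
`μ(1), …, μ(t)` and `ξ(1), …, ξ(t-1)`. -/
@[reducible] def history {N d : ℕ} {Ω : Type*} (μ ξ : ℕ → Ω → Joint N d) (t : ℕ) : MeasurableSpace Ω :=
  (⨆ s ∈ Set.Icc 1 t, MeasurableSpace.comap (μ s) inferInstance) ⊔
    ⨆ s ∈ Set.Ico 1 t, MeasurableSpace.comap (ξ s) inferInstance

/-- The processes `μ` (states), `ξ` (samples) and `a` (played actions) are a run, at the times
`t = 1, 2, …`, of the payoff-based algorithm with one-point gradient estimates, step sizes `γ`,
standard deviations `σ`, shrinking parameters `ρ` and initial state `μ₁`. -/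
structure IsOnePointRun {N d : ℕ} {Ω : Type*} [MeasurableSpace Ω] (P : Measure Ω)
    (A : Fin N → Set (Action d)) (J : Fin N → Joint N d → ℝ) (γ σ ρ : ℕ → ℝ) (μ₁ : Joint N d)
    (μ ξ a : ℕ → Ω → Joint N d) : Prop where
  measurable_sample : ∀ t, 1 ≤ t → Measurable (ξ t)
  init : ∀ ω, μ 1 ω = μ₁
  /-- Conditionally on the history, the players sample independently, and the sample of player `i`
  has the normal law with mean `μ^i(t)` and covariance matrix `σ_t² I`. -/
  sample : ∀ t, 1 ≤ t → ∀ S : Set Ω, MeasurableSet[history μ ξ t] S →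
    ∀ B : Fin N → Set (Action d), (∀ i, MeasurableSet (B i)) →
      P (S ∩ {ω | ∀ i, ξ t ω i ∈ B i}) =
        ∫⁻ ω in S, ∏ i, multivariateGaussian (μ t ω i)
          (σ t ^ 2 • (1 : Matrix (Fin d) (Fin d) ℝ)) (B i) ∂P
  /-- The feasible action is the projection of the sample on the action set. -/
  action : ∀ t, 1 ≤ t → ∀ ω i, IsProj (A i) (ξ t ω i) (a t ω i)
  /-- Projected step along the estimate `J_i(a(t)) (ξ^i(t) - μ^i(t)) / σ_t²`. -/
  update : ∀ t, 1 ≤ t → ∀ ω i,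
    IsProj ((1 - ρ t) • A i)
      (μ t ω i - γ t • ((J i (a t ω) / σ t ^ 2) • (ξ t ω i - μ t ω i)))
      (μ (t + 1) ω i)

end PayoffLearning

end

noncomputable section

namespace PayoffLearning

open scoped RealInnerProductSpace

variable {N d : ℕ}

/-! ### Projections -/

/-! The Nash equilibrium is the solution `b` of the variational inequality for the pseudo-gradient
on the joint action set. It exists by Banach's fixed point theorem and is unique by strong
monotonicity (`exists_unique_isNash`).

The algorithm is a projected stochastic gradient step, compared at each time with the moving target
`(1 - ρ_t) • b`. This target is feasible for the shrunk sets, so projecting onto them cannot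
increase the distance to it. Three estimates control one step.

Bias (`GameBounds.abs_bias_le`): replacing the block of player `i` in the played action by its mean
gives a payoff independent of `z i`, so its product with `z i` integrates to zero by symmetry. The
payoff difference is linear in that block up to `O(σ²)`, and the Gaussian covariance turns the
linear part into the gradient. Projecting the sample matters only when the noise exceeds `r * ρ`, so
its effect is of order `(σ / ρ) ^ k` for any `k`. As `σ_t / ρ_t` decays like `t ^ (-ε)`, a large `k`
makes it negligible.

Variance (`GameBounds.integral_step_le`): played actions are feasible, so payoffs are bounded and
the estimate has second moment `O(1 / σ²)`.

Drift (`GameBounds.drift_ge`): strong monotonicity gives `ν` times the squared distance to the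
target, minus errors caused by the shrinking.

Together (`IsOnePointRun.exists_recursion`) these give `D_{t+1} ≤ (1 - 2 / t) D_t + O(t ^ (-(1 +
2p)))` with `p = 1/4 - ε`, on every event of the past. Taking expectations gives the rate `t ^
(-2p)` (`le_rpow_of_recursion`). Since the errors are summable, a martingale argument gives almost
sure convergence (`ae_tendsto_zero_of_almost_supermartingale`). The samples follow the states
because `σ_t` tends to zero. -/

lemma IsProj.inner_le_zero {S : Set (Action d)} (hS : Convex ℝ S) {x p : Action d}
    (h : IsProj S x p) : ∀ q ∈ S, ⟪x - p, q - p⟫ ≤ 0 := by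
  refine (norm_eq_iInf_iff_real_inner_le_zero hS h.1).1 ?_
  have : Nonempty S := ⟨⟨p, h.1⟩⟩
  refine le_antisymm (le_ciInf fun q => h.2 q q.2) ?_
  exact ciInf_le ⟨0, by rintro _ ⟨q, rfl⟩; exact norm_nonneg _⟩ (⟨p, h.1⟩ : S)

lemma IsProj.norm_sub_le {S : Set (Action d)} (hS : Convex ℝ S) {x y p q : Action d}
    (hp : IsProj S x p) (hq : IsProj S y q) : ‖p - q‖ ≤ ‖x - y‖ := by
  have h1 := hp.inner_le_zero hS q hq.1
  have h2 := hq.inner_le_zero hS p hp.1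
  have h3 : ‖p - q‖ * ‖p - q‖ ≤ ‖x - y‖ * ‖p - q‖ := by
    have h4 := real_inner_le_norm (x - y) (p - q)
    have h5 : ⟪x - y, p - q⟫ = ⟪p - q, p - q⟫ - ⟪x - p, q - p⟫ - ⟪y - q, p - q⟫ := by
      simp only [inner_sub_left, inner_sub_right]; ring
    rw [real_inner_self_eq_norm_mul_norm] at h5
    linarith
  rcases (norm_nonneg (p - q)).eq_or_lt with h | h
  · rw [← h]; positivity
  · exact le_of_mul_le_mul_right h3 h

lemma IsProj.unique {S : Set (Action d)} (hS : Convex ℝ S) {x p q : Action d}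
    (hp : IsProj S x p) (hq : IsProj S x q) : p = q := by
  have := hp.norm_sub_le hS hq
  rw [sub_self, norm_zero] at this
  exact sub_eq_zero.1 (norm_le_zero_iff.1 this)

lemma isProj_self {S : Set (Action d)} {x : Action d} (hx : x ∈ S) : IsProj S x x :=
  ⟨hx, fun q _ => by simp⟩

lemma exists_isProj {S : Set (Action d)} (hne : S.Nonempty) (hcl : IsClosed S)
    (hS : Convex ℝ S) (x : Action d) : ∃ p, IsProj S x p := by
  obtain ⟨p, hp, h⟩ := exists_norm_eq_iInf_of_complete_convex hne hcl.isComplete hS x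
  refine ⟨p, hp, fun q hq => h.le.trans ?_⟩
  exact ciInf_le (⟨0, by rintro _ ⟨q, rfl⟩; exact norm_nonneg _⟩) (⟨q, hq⟩ : S)

open Classical in
/-- A Euclidean projection on `S`, whenever there is one. -/
def proj (S : Set (Action d)) (x : Action d) : Action d :=
  if h : ∃ p, IsProj S x p then h.choose else 0

lemma isProj_proj {S : Set (Action d)} (hne : S.Nonempty) (hcl : IsClosed S)
    (hS : Convex ℝ S) (x : Action d) : IsProj S x (proj S x) := by
  rw [proj, dif_pos (exists_isProj hne hcl hS x)]
  exact (exists_isProj hne hcl hS x).choose_spec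

lemma norm_proj_sub_proj_le {S : Set (Action d)} (hne : S.Nonempty) (hcl : IsClosed S)
    (hS : Convex ℝ S) (x y : Action d) : ‖proj S x - proj S y‖ ≤ ‖x - y‖ :=
  (isProj_proj hne hcl hS x).norm_sub_le hS (isProj_proj hne hcl hS y)

lemma proj_of_mem {S : Set (Action d)} (hne : S.Nonempty) (hcl : IsClosed S)
    (hS : Convex ℝ S) {x : Action d} (hx : x ∈ S) : proj S x = x :=
  (isProj_proj hne hcl hS x).unique hS (isProj_self hx)

/-! ### Joint actions -/

lemma joint_norm_sq (x : Joint N d) : ‖x‖ ^ 2 = ∑ i, ‖x i‖ ^ 2 :=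
  PiLp.norm_sq_eq_of_L2 _ x

lemma joint_inner (x y : Joint N d) : ⟪x, y⟫ = ∑ i, ⟪x i, y i⟫ :=
  PiLp.inner_apply x y

lemma norm_block_le (x : Joint N d) (i : Fin N) : ‖x i‖ ≤ ‖x‖ :=
  PiLp.norm_apply_le x i

lemma norm_le_of_norm_block_le {x y : Joint N d} (h : ∀ i, ‖x i‖ ≤ ‖y i‖) : ‖x‖ ≤ ‖y‖ := by
  refine le_of_sq_le_sq ?_ (norm_nonneg _)
  rw [joint_norm_sq, joint_norm_sq]
  exact Finset.sum_le_sum fun i _ => pow_le_pow_left₀ (norm_nonneg _) (h i) 2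

@[simp] lemma deviate_same (x : Joint N d) (i : Fin N) (y : Action d) : deviate x i y i = y := by
  simp [deviate]

lemma deviate_of_ne (x : Joint N d) {i j : Fin N} (y : Action d) (h : j ≠ i) :
    deviate x i y j = x j := by
  simp [deviate, h]

@[simp] lemma deviate_deviate (x : Joint N d) (i : Fin N) (y z : Action d) :
    deviate (deviate x i y) i z = deviate x i z := by
  simp [deviate]

@[simp] lemma deviate_self (x : Joint N d) (i : Fin N) : deviate x i (x i) = x := by
  ext1 j
  by_cases h : j = i
  · subst h; simp
  · simp [deviate_of_ne, h]

/-- The set of joint actions. -/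
def jointSet (A : Fin N → Set (Action d)) : Set (Joint N d) := {x | ∀ i, x i ∈ A i}

lemma isClosed_jointSet {A : Fin N → Set (Action d)} (hA : ∀ i, IsClosed (A i)) :
    IsClosed (jointSet A) := by
  rw [jointSet, Set.ofPred_forall]
  exact isClosed_iInter fun i => (hA i).preimage (by fun_prop)

lemma convex_jointSet {A : Fin N → Set (Action d)} (hA : ∀ i, Convex ℝ (A i)) :
    Convex ℝ (jointSet A) := by
  intro x hx y hy a b ha hb hab i
  exact hA i (hx i) (hy i) ha hb hab

lemma isCompact_jointSet {A : Fin N → Set (Action d)} (hA : ∀ i, IsCompact (A i)) :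
    IsCompact (jointSet A) := by
  have h := (isCompact_univ_pi hA).image (PiLp.continuous_toLp 2 (fun _ : Fin N => Action d))
  convert h using 1
  ext x
  constructor
  · intro hx
    exact ⟨fun i => x i, fun i _ => hx i, rfl⟩
  · rintro ⟨y, hy, rfl⟩ i
    exact hy i (Set.mem_univ i)

lemma deviate_mem_jointSet {A : Fin N → Set (Action d)} {x : Joint N d} (hx : x ∈ jointSet A)
    {i : Fin N} {y : Action d} (hy : y ∈ A i) : deviate x i y ∈ jointSet A := by
  intro j
  by_cases h : j = i
  · subst h; simpa
  · simpa [deviate_of_ne, h] using hx j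

/-- The blockwise projection on the set of joint actions. -/
def jointProj (A : Fin N → Set (Action d)) (x : Joint N d) : Joint N d :=
  WithLp.toLp 2 (fun i => proj (A i) (x i))

@[simp] lemma jointProj_apply (A : Fin N → Set (Action d)) (x : Joint N d) (i : Fin N) :
    jointProj A x i = proj (A i) (x i) := rfl

/-- Nonempty closed convex action sets. -/
structure Admissible (A : Fin N → Set (Action d)) : Prop where
  nonempty : ∀ i, (A i).Nonempty
  isClosed : ∀ i, IsClosed (A i)
  convex : ∀ i, Convex ℝ (A i)

section
variable {A : Fin N → Set (Action d)}

lemma Admissible.jointProj_mem (hA : Admissible A) (x : Joint N d) : jointProj A x ∈ jointSet A :=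
    fun i =>
  (isProj_proj (hA.nonempty i) (hA.isClosed i) (hA.convex i) (x i)).1

lemma Admissible.norm_jointProj_sub_le (hA : Admissible A) (x y : Joint N d) :
    ‖jointProj A x - jointProj A y‖ ≤ ‖x - y‖ :=
  norm_le_of_norm_block_le fun i =>
    norm_proj_sub_proj_le (hA.nonempty i) (hA.isClosed i) (hA.convex i) (x i) (y i)

lemma Admissible.jointProj_of_mem (hA : Admissible A) {x : Joint N d} (hx : x ∈ jointSet A) :
    jointProj A x = x := by
  ext1 i
  exact proj_of_mem (hA.nonempty i) (hA.isClosed i) (hA.convex i) (hx i)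

lemma Admissible.continuous_jointProj (hA : Admissible A) : Continuous (jointProj A) :=
  (LipschitzWith.of_dist_le_mul (K := 1) fun x y => by
    simpa [dist_eq_norm] using hA.norm_jointProj_sub_le x y).continuous

lemma Admissible.inner_jointProj_le_zero (hA : Admissible A) (x : Joint N d) {y : Joint N d}
    (hy : y ∈ jointSet A) :
    ⟪x - jointProj A x, y - jointProj A x⟫ ≤ 0 := by
  rw [joint_inner]
  exact Finset.sum_nonpos fun i _ =>
    (isProj_proj (hA.nonempty i) (hA.isClosed i) (hA.convex i) (x i)).inner_le_zero
      (hA.convex i) _ (hy i)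

/-- A strongly monotone Lipschitz variational inequality has a solution. -/
lemma Admissible.exists_variational_solution (hA : Admissible A) {F : Joint N d → Joint N d}
    {ν L : ℝ} (hν : 0 < ν)
    (hF : StronglyMonotone ν F)
    (hL : ∀ x ∈ jointSet A, ∀ y ∈ jointSet A, ‖F x - F y‖ ≤ L * ‖x - y‖) :
    ∃ a ∈ jointSet A, ∀ y ∈ jointSet A, 0 ≤ ⟪F a, y - a⟫ := by
  -- The step `τ = ν / R ^ 2` minimizes the squared contraction factor `1 - 2τν + τ²R²`, with value
  -- `1 - (ν / R) ^ 2`. Taking `R ≥ ν` keeps this nonnegative.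
  set R := max L ν
  have hR : 0 < R := lt_max_of_lt_right hν
  have hνR : ν ≤ R := le_max_right _ _
  set τ := ν / R ^ 2 with hτ
  have hτ0 : 0 < τ := by positivity
  let G : Joint N d → Joint N d := fun x => jointProj A (x - τ • F x)
  set k := Real.sqrt (1 - (ν / R) ^ 2) with hk
  have hq : (ν / R) ^ 2 ≤ 1 := by
    rw [sq_le_one_iff_abs_le_one, abs_of_pos (by positivity), div_le_one hR]; exact hνR
  have hq0 : 0 < (ν / R) ^ 2 := by positivity
  have hk1 : k < 1 := by
    rw [hk, Real.sqrt_lt' one_pos]; linarith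
  have hmaps : Set.MapsTo G (jointSet A) (jointSet A) := fun x _ => hA.jointProj_mem _
  have hcontr : ∀ x ∈ jointSet A, ∀ y ∈ jointSet A, ‖G x - G y‖ ≤ k * ‖x - y‖ := by
    intro x hx y hy
    refine (hA.norm_jointProj_sub_le _ _).trans ?_
    refine le_of_sq_le_sq ?_ (by positivity)
    have e1 : x - τ • F x - (y - τ • F y) = (x - y) - τ • (F x - F y) := by
      rw [smul_sub]; abel
    rw [e1, norm_sub_sq_real, inner_smul_right, norm_smul, mul_pow, mul_pow, hk,
      Real.sq_sqrt (by linarith), Real.norm_of_nonneg hτ0.le, real_inner_comm]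
    have h1 := hF x y
    have h2 : ‖F x - F y‖ ^ 2 ≤ R ^ 2 * ‖x - y‖ ^ 2 := by
      rw [← mul_pow]
      exact pow_le_pow_left₀ (norm_nonneg _)
        ((hL x hx y hy).trans (by gcongr; exact le_max_left _ _)) 2
    have h3 : τ * (ν * ‖x - y‖ ^ 2) ≤ τ * ⟪F x - F y, x - y⟫ := by gcongr
    have h4 : τ ^ 2 * ‖F x - F y‖ ^ 2 ≤ τ ^ 2 * (R ^ 2 * ‖x - y‖ ^ 2) := by gcongr
    have h5 : τ ^ 2 * (R ^ 2 * ‖x - y‖ ^ 2) = (ν / R) ^ 2 * ‖x - y‖ ^ 2 := by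
      rw [hτ]; field_simp
    have h6 : τ * (ν * ‖x - y‖ ^ 2) = (ν / R) ^ 2 * ‖x - y‖ ^ 2 := by
      rw [hτ]; field_simp
    linarith
  have hcomplete : IsComplete (jointSet A) := (isClosed_jointSet hA.isClosed).isComplete
  have hCW : ContractingWith ⟨k, Real.sqrt_nonneg _⟩ (hmaps.restrict G _ _) := by
    refine ⟨hk1, LipschitzWith.of_dist_le_mul fun x y => ?_⟩
    rw [Subtype.dist_eq, Subtype.dist_eq, dist_eq_norm, dist_eq_norm]
    exact hcontr x x.2 y y.2
  obtain ⟨a, ha, hfix, -⟩ := hCW.exists_fixedPoint' hcomplete hmaps (hA.jointProj_mem 0)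
    (edist_ne_top _ _)
  refine ⟨a, ha, fun y hy => ?_⟩
  have h := hA.inner_jointProj_le_zero (a - τ • F a) hy
  have hfix' : jointProj A (a - τ • F a) = a := hfix
  rw [hfix', sub_sub_cancel_left, inner_neg_left, inner_smul_left] at h
  have h' : 0 ≤ τ * ⟪F a, y - a⟫ := by simpa using h
  exact nonneg_of_mul_nonneg_right h' hτ0

end

/-! ### The pseudo-gradient -/

section
variable {J : Fin N → Joint N d → ℝ}

lemma differentiable_deviate (hJ : ∀ i, ContDiff ℝ 1 (J i)) (x : Joint N d) (i : Fin N) :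
    Differentiable ℝ (fun y : Action d => J i (deviate x i y)) := by
  refine ((hJ i).differentiable one_ne_zero).comp ?_
  unfold deviate
  refine Differentiable.comp (fun f => (PiLp.hasFDerivAt_toLp 2 f).differentiableAt) ?_
  rw [differentiable_pi]
  intro j
  by_cases h : j = i
  · subst h; simp
  · simp [h]

lemma hasGradientAt_deviate (hJ : ∀ i, ContDiff ℝ 1 (J i)) (x : Joint N d) (i : Fin N)
    (y : Action d) :
    HasGradientAt (fun y : Action d => J i (deviate x i y))
      (pseudoGradient J (deviate x i y) i) y := by
  have h := (differentiable_deviate hJ x i y).hasGradientAt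
  simpa [pseudoGradient] using h

/-- Mean value inequality in the block of player `i` alone, the other blocks staying at those of
`b`. Along the segment from `m i` to `b i` the joint action remains within `‖b - m‖` of `m`, so the
partial gradient varies by at most `L * ‖b - m‖`. -/
lemma abs_sub_sub_inner_pseudoGradient_le (hJ : ∀ i, ContDiff ℝ 1 (J i))
    {A : Fin N → Set (Action d)}
    (hA : ∀ i, Convex ℝ (A i)) {L : ℝ} (hL0 : 0 ≤ L)
    (hL : ∀ x ∈ jointSet A, ∀ y ∈ jointSet A,
      ‖pseudoGradient J x - pseudoGradient J y‖ ≤ L * ‖x - y‖)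
    {b m : Joint N d} (hb : b ∈ jointSet A) (hm : m ∈ jointSet A) (i : Fin N) :
    |J i b - J i (deviate b i (m i)) - ⟪pseudoGradient J m i, b i - m i⟫| ≤
      L * ‖b - m‖ * ‖b i - m i‖ := by
  have key := Convex.norm_image_sub_le_of_norm_hasFDerivWithin_le' (𝕜 := ℝ)
    (f := fun y : Action d => J i (deviate b i y)) (s := segment ℝ (m i) (b i))
    (f' := fun y => innerSL ℝ (pseudoGradient J (deviate b i y) i))
    (φ := innerSL ℝ (pseudoGradient J m i)) (C := L * ‖b - m‖) (x := m i) (y := b i)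
    (fun y _ => (hasGradientAt_deviate hJ b i y).hasFDerivAt.hasFDerivWithinAt) ?_
    (convex_segment _ _) (left_mem_segment _ _ _) (right_mem_segment _ _ _)
  · simpa using key
  intro y hy
  rw [← map_sub, innerSL_apply_norm]
  refine (norm_block_le (pseudoGradient J (deviate b i y) - pseudoGradient J m) i).trans ?_
  refine (hL _ (deviate_mem_jointSet hb ((hA i).segment_subset (hm i) (hb i) hy)) _ hm).trans ?_
  gcongr
  refine norm_le_of_norm_block_le fun j => ?_
  by_cases h : j = i
  · subst h
    simp only [PiLp.sub_apply, deviate_same]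
    rw [segment_eq_image'] at hy
    obtain ⟨θ, hθ, rfl⟩ := hy
    rw [add_sub_cancel_left, norm_smul, Real.norm_of_nonneg hθ.1]
    exact mul_le_of_le_one_left (norm_nonneg _) hθ.2
  · simp [deviate_of_ne, h]

end

/-- A `C¹` or Lipschitz map is Lipschitz continuous on a compact convex set. -/
lemma exists_lipschitz_on {E : Type*} [NormedAddCommGroup E] [NormedSpace ℝ E]
    {F : E → E} {K : Set E} (hK : IsCompact K)
    (hKc : Convex ℝ K)
    (hF : (Differentiable ℝ F ∧ Differentiable ℝ (fderiv ℝ F)) ∨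
      (Differentiable ℝ F ∧ ∃ C : NNReal, LipschitzWith C F)) :
    ∃ L : ℝ, 0 ≤ L ∧ ∀ x ∈ K, ∀ y ∈ K, ‖F x - F y‖ ≤ L * ‖x - y‖ := by
  rcases hF with ⟨h1, h2⟩ | ⟨-, C, hC⟩
  · obtain ⟨L, hL⟩ := hK.exists_bound_of_continuousOn h2.continuous.continuousOn
    refine ⟨max L 0, le_max_right _ _, fun x hx y hy => ?_⟩
    exact hKc.norm_image_sub_le_of_norm_fderiv_le (𝕜 := ℝ) (fun z _ => h1 z)
      (fun z hz => (hL z hz).trans (le_max_left _ _)) hy hx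
  · exact ⟨C, C.2, fun x _ y _ => by simpa [dist_eq_norm] using hC.dist_le_mul x y⟩

/-! ### Nash equilibria as solutions of a variational inequality -/

section
variable {A : Fin N → Set (Action d)} {J : Fin N → Joint N d → ℝ}

lemma IsNash.inner_nonneg (hJ : ∀ i, ContDiff ℝ 1 (J i)) (hA : ∀ i, Convex ℝ (A i)) {a : Joint N d}
    (ha : IsNash A J a)
    {y : Joint N d} (hy : y ∈ jointSet A) : 0 ≤ ⟪pseudoGradient J a, y - a⟫ := by
  rw [joint_inner]
  refine Finset.sum_nonneg fun i _ => ?_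
  have hg := (hasGradientAt_deviate hJ a i (a i)).hasFDerivAt
  rw [deviate_self] at hg
  have hmin : IsLocalMinOn (fun y : Action d => J i (deviate a i y)) (A i) (a i) := by
    refine IsMinOn.localize fun z hz => ?_
    simpa using ha.2 i z hz
  have h := hmin.hasFDerivWithinAt_nonneg hg.hasFDerivWithinAt
    (sub_mem_posTangentConeAt_of_segment_subset ((hA i).segment_subset (ha.1 i) (hy i)))
  simpa using h

lemma isNash_of_inner_nonneg (hJ : ∀ i, ContDiff ℝ 1 (J i))
    (hJc : ∀ i x, ConvexOn ℝ Set.univ (fun y : Action d => J i (deviate x i y)))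
    {a : Joint N d} (ha : a ∈ jointSet A)
    (hvi : ∀ y ∈ jointSet A, 0 ≤ ⟪pseudoGradient J a, y - a⟫) : IsNash A J a := by
  refine ⟨ha, fun i y hy => ?_⟩
  -- Testing the inequality with a unilateral deviation isolates one block. By convexity the chord
  -- from `a i` to `y` is at least as steep as the derivative at `a i`.
  have h := hvi _ (deviate_mem_jointSet ha hy)
  rw [joint_inner, Finset.sum_eq_single i (fun j _ hj => by simp [deviate_of_ne, hj])
    (fun hi => absurd (Finset.mem_univ i) hi)] at h
  have hg := hasGradientAt_deviate hJ a i (a i)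
  rw [deviate_self] at hg
  have hline : HasDerivAt ((fun y : Action d => J i (deviate a i y)) ∘ AffineMap.lineMap (a i) y)
      ⟪pseudoGradient J a i, y - a i⟫ (0 : ℝ) := by
    have := HasFDerivAt.comp_hasDerivAt (0 : ℝ) (by simpa using hg.hasFDerivAt)
      (AffineMap.hasDerivAt_lineMap (a := a i) (b := y) (x := (0 : ℝ)))
    simpa using this
  have hslope := ((hJc i a).comp_affineMap (AffineMap.lineMap (k := ℝ) (a i) y)).le_slope_of_hasDerivAt
    (Set.mem_univ 0) (Set.mem_univ 1) one_pos hline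
  simp only [slope_def_field, Function.comp, AffineMap.lineMap_apply_one,
    AffineMap.lineMap_apply_zero, deviate_self, sub_zero, div_one] at hslope
  simp only [PiLp.sub_apply, deviate_same] at h
  linarith

end

/-- The game has a unique Nash equilibrium, characterized by a variational inequality. -/
lemma exists_unique_isNash {A : Fin N → Set (Action d)} {J : Fin N → Joint N d → ℝ}
    (hA : Admissible A) (hJ : ∀ i, ContDiff ℝ 1 (J i))
    (hJc : ∀ i x, ConvexOn ℝ Set.univ (fun y : Action d => J i (deviate x i y)))
    {ν L : ℝ} (hν : 0 < ν) (hM : StronglyMonotone ν (pseudoGradient J))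
    (hL : ∀ x ∈ jointSet A, ∀ y ∈ jointSet A,
      ‖pseudoGradient J x - pseudoGradient J y‖ ≤ L * ‖x - y‖) :
    ∃ a, IsNash A J a ∧ (∀ b, IsNash A J b → b = a) ∧
      ∀ y ∈ jointSet A, 0 ≤ ⟪pseudoGradient J a, y - a⟫ := by
  obtain ⟨a, ha, hvi⟩ := hA.exists_variational_solution hν hM hL
  refine ⟨a, isNash_of_inner_nonneg hJ hJc ha hvi, fun b hb => ?_, hvi⟩
  have h1 := hvi b hb.1
  have h2 := hb.inner_nonneg hJ hA.convex ha
  -- Adding the two variational inequalities, each tested at the other solution, contradicts strong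
  -- monotonicity unless `b = a`.
  have h3 := hM b a
  have h4 : ⟪pseudoGradient J b - pseudoGradient J a, b - a⟫ =
      -⟪pseudoGradient J b, a - b⟫ - ⟪pseudoGradient J a, b - a⟫ := by
    rw [inner_sub_left, ← inner_neg_right, neg_sub]
  have h5 : ν * ‖b - a‖ ^ 2 ≤ 0 := by linarith
  have h6 : ‖b - a‖ ^ 2 = 0 :=
    le_antisymm (nonpos_of_mul_nonpos_right h5 hν) (by positivity)
  exact sub_eq_zero.1 (norm_eq_zero.1 (pow_eq_zero_iff two_ne_zero |>.1 h6))

/-! ### Gaussian measures -/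

lemma stdGaussian_joint_eq_map_pi :
    (Measure.pi fun _ : Fin N => stdGaussian (Action d)).map (WithLp.toLp 2) =
      stdGaussian (Joint N d) := by
  apply Measure.ext_of_charFun (E := Joint N d)
  ext t
  simp_rw [charFun_stdGaussian, charFun_pi, charFun_stdGaussian, ← Complex.exp_sum,
    ← Complex.ofReal_pow, joint_norm_sq t]
  simp [Finset.sum_div, neg_div]

open scoped MatrixOrder in
lemma multivariateGaussian_smul_one (m : Action d) {σ : ℝ} (hσ : 0 ≤ σ) :
    multivariateGaussian m (σ ^ 2 • (1 : Matrix (Fin d) (Fin d) ℝ)) =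
      (stdGaussian (Action d)).map (fun z => m + σ • z) := by
  have hsq : CFC.sqrt (σ ^ 2 • (1 : Matrix (Fin d) (Fin d) ℝ)) = σ • 1 := by
    refine CFC.sqrt_unique ?_ ?_
    · simp [sq, smul_smul]
    · exact (Matrix.PosSemidef.one.smul hσ).nonneg
  rw [multivariateGaussian, hsq]
  simp

lemma stdGaussian_joint_preimage_pi (m : Joint N d) {σ : ℝ} (hσ : 0 ≤ σ)
    {B : Fin N → Set (Action d)} (hB : ∀ i, MeasurableSet (B i)) :
    stdGaussian (Joint N d) {z | ∀ i, (m + σ • z) i ∈ B i} =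
      ∏ i, multivariateGaussian (m i) (σ ^ 2 • (1 : Matrix (Fin d) (Fin d) ℝ)) (B i) := by
  have hmeas : MeasurableSet {z : Joint N d | ∀ i, (m + σ • z) i ∈ B i} := by
    rw [Set.ofPred_forall]
    exact MeasurableSet.iInter fun i => (hB i).preimage (by fun_prop)
  rw [← stdGaussian_joint_eq_map_pi, Measure.map_apply (by fun_prop) hmeas]
  have : WithLp.toLp 2 ⁻¹' {z : Joint N d | ∀ i, (m + σ • z) i ∈ B i} =
      Set.univ.pi fun i => (fun z : Action d => m i + σ • z) ⁻¹' B i := by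
    ext z; simp [Set.mem_pi]
  rw [this, Measure.pi_pi]
  refine Finset.prod_congr rfl fun i _ => ?_
  rw [multivariateGaussian_smul_one _ hσ, Measure.map_apply (by fun_prop) (hB i)]

lemma integral_inner_mul_inner_stdGaussian {E : Type*} [NormedAddCommGroup E]
    [InnerProductSpace ℝ E] [FiniteDimensional ℝ E] [MeasurableSpace E] [BorelSpace E] (x y : E) :
    ∫ z, ⟪x, z⟫ * ⟪y, z⟫ ∂(stdGaussian E) = ⟪x, y⟫ := by
  have h := covarianceBilin_apply (μ := stdGaussian E) IsGaussian.memLp_two_id x y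
  rw [covarianceBilin_stdGaussian, innerSL_apply_apply ℝ] at h
  simpa using h.symm

lemma integral_block_inner_mul_inner (i : Fin N) (v w : Action d) :
    ∫ z : Joint N d, ⟪v, z i⟫ * ⟪z i, w⟫ ∂(stdGaussian (Joint N d)) = ⟪v, w⟫ := by
  have h : ∀ (u : Action d) (z : Joint N d), ⟪deviate 0 i u, z⟫ = ⟪u, z i⟫ := fun u z => by
    rw [joint_inner, Finset.sum_eq_single i (fun j _ hj => by simp [deviate_of_ne, hj])
      (fun hi => absurd (Finset.mem_univ i) hi), deviate_same]
  have h1 := integral_inner_mul_inner_stdGaussian (deviate (0 : Joint N d) i v) (deviate 0 i w)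
  simp_rw [h, deviate_same] at h1
  simpa [real_inner_comm] using h1

lemma integrable_norm_pow_stdGaussian {E : Type*} [NormedAddCommGroup E]
    [InnerProductSpace ℝ E] [FiniteDimensional ℝ E] [MeasurableSpace E] [BorelSpace E] (k : ℕ) :
    Integrable (fun z : E => ‖z‖ ^ k) (stdGaussian E) := by
  have h := (IsGaussian.memLp_id (stdGaussian E) (k : ENNReal) (by simp)).integrable_norm_pow'
  simpa using h

/-- Change of sign of the block of player `i`. -/
def flipBlock (i : Fin N) : Joint N d ≃ₗᵢ[ℝ] Joint N d :=
  LinearIsometryEquiv.piLpCongrRight 2 fun j =>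
    if j = i then LinearIsometryEquiv.neg ℝ else LinearIsometryEquiv.refl ℝ _

lemma flipBlock_same (i : Fin N) (z : Joint N d) : flipBlock i z i = -z i := by
  simp [flipBlock]

lemma flipBlock_of_ne {i j : Fin N} (h : j ≠ i) (z : Joint N d) : flipBlock i z j = z j := by
  simp [flipBlock, h]

/-- The standard Gaussian is invariant under linear isometries, so the integral equals its own
opposite. -/
lemma integral_eq_zero_of_flipBlock (i : Fin N) {g : Joint N d → ℝ}
    (hg : ∀ z, g (flipBlock i z) = -g z) : ∫ z, g z ∂(stdGaussian (Joint N d)) = 0 := by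
  have hmp : MeasurePreserving (flipBlock (N := N) (d := d) i) (stdGaussian (Joint N d))
      (stdGaussian (Joint N d)) :=
    ⟨(flipBlock i).continuous.measurable, stdGaussian_map (flipBlock i)⟩
  have h := hmp.integral_comp (flipBlock i).toHomeomorph.measurableEmbedding g
  simp_rw [hg, integral_neg] at h
  linarith

/-! ### Conditional law of the samples -/

/-- Passes from the sampling rule, known only on boxes, to the full joint law of state and sample:
the noise is standard Gaussian and independent of the state on `S`. Products of a measurable set
with a box form a generating π-system, so equality there and of the total masses suffices. -/
lemma map_restrict_eq_of_gaussian_sample {Ω : Type*} [MeasurableSpace Ω] {P : Measure Ω}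
    [IsFiniteMeasure P] {X Y : Ω → Joint N d} (hX : Measurable X) (hY : Measurable Y) {σ : ℝ}
    (hσ : 0 ≤ σ) {S : Set Ω}
    (h : ∀ C : Set (Joint N d), MeasurableSet C → ∀ B : Fin N → Set (Action d),
      (∀ i, MeasurableSet (B i)) →
      P (S ∩ X ⁻¹' C ∩ {ω | ∀ i, Y ω i ∈ B i}) =
        ∫⁻ ω in S ∩ X ⁻¹' C, ∏ i, multivariateGaussian (X ω i)
          (σ ^ 2 • (1 : Matrix (Fin d) (Fin d) ℝ)) (B i) ∂P) :
    (P.restrict S).map (fun ω => (X ω, Y ω)) =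
      (((P.restrict S).map X).prod (stdGaussian (Joint N d))).map
        (fun q => (q.1, q.1 + σ • q.2)) := by
  let 𝒞 : Set (Set (Joint N d)) :=
    {D | ∃ B : Fin N → Set (Action d), (∀ i, MeasurableSet (B i)) ∧ D = {x | ∀ i, x i ∈ B i}}
  have hrect : ∀ B : Fin N → Set (Action d), (∀ i, MeasurableSet (B i)) →
      MeasurableSet {x : Joint N d | ∀ i, x i ∈ B i} := fun B hB => by
    rw [Set.ofPred_forall]
    exact MeasurableSet.iInter fun i => (hB i).preimage (by fun_prop)
  have hgen : MeasurableSpace.generateFrom 𝒞 = (inferInstance : MeasurableSpace (Joint N d)) := by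
    refine le_antisymm (MeasurableSpace.generateFrom_le ?_) ?_
    · rintro _ ⟨B, hB, rfl⟩
      exact hrect B hB
    · have h1 : Measurable[MeasurableSpace.generateFrom 𝒞]
          (fun x : Joint N d => fun i => x i) := by
        refine @measurable_pi_lambda _ _ _ (MeasurableSpace.generateFrom 𝒞) _ _ fun i B hB => ?_
        refine MeasurableSpace.measurableSet_generateFrom
          ⟨fun j => if j = i then B else Set.univ, fun j => ?_, ?_⟩
        · dsimp only
          split_ifs
          exacts [hB, MeasurableSet.univ]
        · ext x
          constructor
          · intro hx j
            dsimp only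
            split_ifs with hj
            · subst hj; exact hx
            · trivial
          · intro hx
            simpa using hx i
      have h2 : Measurable (WithLp.toLp 2 : (∀ _ : Fin N, Action d) → Joint N d) := by fun_prop
      intro D hD
      exact h1 (h2 hD)
  have hpi : IsPiSystem 𝒞 := by
    rintro _ ⟨B, hB, rfl⟩ _ ⟨B', hB', rfl⟩ -
    refine ⟨fun i => B i ∩ B' i, fun i => (hB i).inter (hB' i), ?_⟩
    ext x
    simp [forall_and]
  have hspan : IsCountablySpanning 𝒞 :=
    ⟨fun _ => Set.univ, fun _ => ⟨fun _ => Set.univ, fun _ => MeasurableSet.univ, by simp⟩,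
      Set.iUnion_const _⟩
  have hφ : Measurable (fun q : Joint N d × Joint N d => (q.1, q.1 + σ • q.2)) := by fun_prop
  refine ext_of_generate_finite _ (generateFrom_eq_prod (C := {C | MeasurableSet C}) (D := 𝒞)
    MeasurableSpace.generateFrom_measurableSet hgen isCountablySpanning_measurableSet hspan).symm
    (MeasurableSpace.isPiSystem_measurableSet.prod hpi) ?_ ?_
  · rintro _ ⟨C, hC, _, ⟨B, hB, rfl⟩, rfl⟩
    replace hC : MeasurableSet C := hC
    have hCB : MeasurableSet (C ×ˢ {x : Joint N d | ∀ i, x i ∈ B i}) := hC.prod (hrect B hB)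
    rw [Measure.map_apply (hX.prodMk hY) hCB, Measure.map_apply hφ hCB,
      Measure.restrict_apply (hX.prodMk hY hCB), Measure.prod_apply (hφ hCB),
      lintegral_map (measurable_measure_prodMk_left (hφ hCB)) hX]
    have e1 : (fun ω => (X ω, Y ω)) ⁻¹' C ×ˢ {x : Joint N d | ∀ i, x i ∈ B i} ∩ S =
        S ∩ X ⁻¹' C ∩ {ω | ∀ i, Y ω i ∈ B i} := by
      ext ω; simp only [Set.mem_inter_iff, Set.mem_preimage, Set.mem_prod, Set.mem_ofPred_eq]
      tauto
    have e2 : ∀ ω, stdGaussian (Joint N d) (Prod.mk (X ω) ⁻¹'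
        ((fun q : Joint N d × Joint N d => (q.1, q.1 + σ • q.2)) ⁻¹'
          C ×ˢ {x : Joint N d | ∀ i, x i ∈ B i})) =
        (X ⁻¹' C).indicator (fun ω => ∏ i, multivariateGaussian (X ω i)
          (σ ^ 2 • (1 : Matrix (Fin d) (Fin d) ℝ)) (B i)) ω := by
      intro ω
      by_cases hω : X ω ∈ C
      · rw [Set.indicator_of_mem (by exact hω), ← stdGaussian_joint_preimage_pi _ hσ hB]
        congr 1
        ext z
        simp [hω]
      · rw [Set.indicator_of_notMem (by exact hω)]
        convert measure_empty (μ := stdGaussian (Joint N d)) using 2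
        ext z
        simp [hω]
    simp_rw [e2]
    rw [e1, h C hC B hB, lintegral_indicator (hX hC), Measure.restrict_restrict (hX hC),
      Set.inter_comm]
  · rw [Measure.map_apply (hX.prodMk hY) MeasurableSet.univ,
      Measure.map_apply hφ MeasurableSet.univ, Set.preimage_univ, Set.preimage_univ,
      ← Set.univ_prod_univ, Measure.prod_prod, measure_univ (μ := stdGaussian (Joint N d)), mul_one,
      Measure.map_apply hX MeasurableSet.univ, Set.preimage_univ]

/-! ### The one-point gradient estimate -/

/-- The `k`-th moment of the norm of a standard Gaussian vector. -/
def gaussMoment (N d k : ℕ) : ℝ := ∫ z, ‖z‖ ^ k ∂(stdGaussian (Joint N d))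

lemma gaussMoment_nonneg (k : ℕ) : 0 ≤ gaussMoment N d k :=
  integral_nonneg fun z => by positivity

lemma abs_block_inner_le (z : Joint N d) (i : Fin N) (w : Action d) :
    |⟪z i, w⟫| ≤ ‖z‖ * ‖w‖ :=
  (abs_real_inner_le_norm _ _).trans (by gcongr; exact norm_block_le z i)

/-- A ball around a point of the shrunk set `(1 - ρ) • S` is contained in `S`. -/
lemma mem_of_norm_sub_lt {S : Set (Action d)} (hS : Convex ℝ S) {r ρ : ℝ}
    (hr : Metric.ball 0 r ⊆ S) (hρ0 : 0 < ρ) (hρ1 : ρ ≤ 1) {m u : Action d}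
    (hm : m ∈ (1 - ρ) • S) (hu : ‖u - m‖ < r * ρ) : u ∈ S := by
  obtain ⟨y, hy, rfl⟩ := hm
  -- The point `u` is the convex combination, with weights `1 - ρ` and `ρ`, of `y` and this point of
  -- the ball.
  have h : ρ⁻¹ • (u - (1 - ρ) • y) ∈ S := by
    apply hr
    rw [mem_ball_zero_iff, norm_smul, norm_inv, Real.norm_of_nonneg hρ0.le, inv_mul_lt_iff₀ hρ0,
      mul_comm]
    exact hu
  have h2 := hS hy h (sub_nonneg.2 hρ1) hρ0.le (by ring)
  rw [smul_smul, mul_inv_cancel₀ hρ0.ne', one_smul] at h2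
  simpa using h2

lemma shrink_subset {S : Set (Action d)} (hS : Convex ℝ S) (h0 : (0 : Action d) ∈ S) {ρ : ℝ}
    (hρ0 : 0 ≤ ρ) (hρ1 : ρ ≤ 1) : (1 - ρ) • S ⊆ S := by
  rintro _ ⟨y, hy, rfl⟩
  exact hS.smul_mem_of_zero_mem h0 hy ⟨by linarith, by linarith⟩

/-- The error of the projected step: it vanishes near the centre, and hence is of arbitrarily high
order. -/
lemma norm_proj_sub_sub_le {S : Set (Action d)} (hcl : IsClosed S) (hS : Convex ℝ S) {r ρ : ℝ}
    (hr0 : 0 < r) (hr : Metric.ball 0 r ⊆ S) (hρ0 : 0 < ρ) (hρ1 : ρ ≤ 1) {m : Action d}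
    (hm : m ∈ (1 - ρ) • S) (u : Action d) (k : ℕ) :
    ‖proj S u - u‖ ≤ 2 * ‖u - m‖ * (‖u - m‖ / (r * ρ)) ^ k := by
  have h0 : (0 : Action d) ∈ S := hr (by simpa using hr0)
  by_cases hu : ‖u - m‖ < r * ρ
  · rw [proj_of_mem ⟨0, h0⟩ hcl hS (mem_of_norm_sub_lt hS hr hρ0 hρ1 hm hu), sub_self, norm_zero]
    positivity
  -- Far from `m` the quotient is at least one, so any power of it can be inserted into the trivial
  -- bound by nonexpansiveness.
  · have hmS := shrink_subset hS h0 hρ0.le hρ1 hm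
    have h1 : ‖proj S u - m‖ ≤ ‖u - m‖ := by
      simpa [proj_of_mem ⟨0, h0⟩ hcl hS hmS] using norm_proj_sub_proj_le ⟨0, h0⟩ hcl hS u m
    have h2 : ‖proj S u - u‖ ≤ 2 * ‖u - m‖ := by
      have : proj S u - u = (proj S u - m) - (u - m) := by abel
      rw [this]
      exact (norm_sub_le _ _).trans (by linarith)
    refine h2.trans (le_mul_of_one_le_right (by positivity) (one_le_pow₀ ?_))
    rw [one_le_div (by positivity)]
    exact not_lt.1 hu

/-- The constants of the game. -/
structure GameBounds (A : Fin N → Set (Action d)) (J : Fin N → Joint N d → ℝ)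
    (r L B R : ℝ) : Prop where
  isCompact : ∀ i, IsCompact (A i)
  convex : ∀ i, Convex ℝ (A i)
  smooth : ∀ i, ContDiff ℝ 1 (J i)
  r_pos : 0 < r
  ball_subset : ∀ i, Metric.ball 0 r ⊆ A i
  L_nonneg : 0 ≤ L
  lipschitz : ∀ x ∈ jointSet A, ∀ y ∈ jointSet A,
      ‖pseudoGradient J x - pseudoGradient J y‖ ≤ L * ‖x - y‖
  B_nonneg : 0 ≤ B
  cost_le : ∀ i, ∀ x ∈ jointSet A, |J i x| ≤ B
  grad_le : ∀ x ∈ jointSet A, ‖pseudoGradient J x‖ ≤ B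
  norm_le : ∀ x ∈ jointSet A, ‖x‖ ≤ R

section
variable {A : Fin N → Set (Action d)} {J : Fin N → Joint N d → ℝ} {r L B R : ℝ}

lemma GameBounds.zero_mem (hG : GameBounds A J r L B R) (i : Fin N) : (0 : Action d) ∈ A i :=
  hG.ball_subset i (by simpa using hG.r_pos)

lemma GameBounds.isClosed (hG : GameBounds A J r L B R) (i : Fin N) : IsClosed (A i) :=
    (hG.isCompact i).isClosed

lemma GameBounds.admissible (hG : GameBounds A J r L B R) : Admissible A :=
  ⟨fun i => ⟨0, hG.zero_mem i⟩, hG.isClosed, hG.convex⟩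

lemma GameBounds.continuous_cost (hG : GameBounds A J r L B R) (i : Fin N) :
    Continuous fun z => J i (jointProj A z) :=
  (hG.smooth i).continuous.comp hG.admissible.continuous_jointProj

lemma GameBounds.abs_cost_le (hG : GameBounds A J r L B R) (i : Fin N) (z : Joint N d) :
    |J i (jointProj A z)| ≤ B :=
  hG.cost_le i _ (hG.admissible.jointProj_mem z)

/-- The pointwise expansion of the payoff around the mean `m`. -/
lemma GameBounds.abs_expansion_le (hG : GameBounds A J r L B R) {ρ σ : ℝ} (hρ0 : 0 < ρ)
    (hρ1 : ρ ≤ 1) (hσ : 0 < σ)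
    {m : Joint N d} (hm : ∀ i, m i ∈ (1 - ρ) • A i) (i : Fin N) (k : ℕ) (z : Joint N d)
    (w : Action d) :
    |J i (jointProj A (m + σ • z)) / σ * ⟪z i, w⟫
        - J i (deviate (jointProj A (m + σ • z)) i (m i)) / σ * ⟪z i, w⟫
        - ⟪pseudoGradient J m i, z i⟫ * ⟪z i, w⟫| ≤
      ‖w‖ * (L * σ * ‖z‖ ^ 3 + 2 * B * (σ / (r * ρ)) ^ k * ‖z‖ ^ (k + 2)) := by
  set b := jointProj A (m + σ • z) with hb
  set g := pseudoGradient J m i with hg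
  have hmA : m ∈ jointSet A := fun j =>
    shrink_subset (hG.convex j) (hG.zero_mem j) hρ0.le hρ1 (hm j)
  have hbA : b ∈ jointSet A := hG.admissible.jointProj_mem _
  have hzi : ‖z i‖ ≤ ‖z‖ := norm_block_le z i
  have h1 := abs_sub_sub_inner_pseudoGradient_le hG.smooth hG.convex hG.L_nonneg hG.lipschitz
    hbA hmA i
  have hbm : ‖b - m‖ ≤ σ * ‖z‖ := by
    have := hG.admissible.norm_jointProj_sub_le (m + σ • z) m
    rw [hG.admissible.jointProj_of_mem hmA, add_sub_cancel_left, norm_smul,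
      Real.norm_of_nonneg hσ.le] at this
    exact this
  have hbmi : ‖b i - m i‖ ≤ σ * ‖z‖ := (norm_block_le (b - m) i).trans hbm
  have h2 : ‖b i - (m i + σ • z i)‖ ≤ 2 * (σ * ‖z‖) * (σ / (r * ρ) * ‖z‖) ^ k := by
    have := norm_proj_sub_sub_le (hG.isClosed i) (hG.convex i) hG.r_pos (hG.ball_subset i)
      hρ0 hρ1 (hm i) (m i + σ • z i) k
    rw [add_sub_cancel_left, norm_smul, Real.norm_of_nonneg hσ.le] at this
    refine this.trans ?_
    have hr := hG.r_pos
    have e : σ * ‖z i‖ / (r * ρ) = σ / (r * ρ) * ‖z i‖ := by ring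
    rw [e]
    gcongr
  have hgB : ‖g‖ ≤ B := (norm_block_le (pseudoGradient J m) i).trans (hG.grad_le m hmA)
  -- The error splits into the Taylor remainder, of order `σ²`, and the effect of projecting the
  -- sample; both are then divided by `σ`.
  have e1 : J i b / σ * ⟪z i, w⟫ - J i (deviate b i (m i)) / σ * ⟪z i, w⟫ - ⟪g, z i⟫ * ⟪z i, w⟫
      = ((J i b - J i (deviate b i (m i)) - ⟪g, b i - m i⟫) + ⟪g, b i - (m i + σ • z i)⟫) / σ
        * ⟪z i, w⟫ := by
    have : ⟪g, b i - (m i + σ • z i)⟫ = ⟪g, b i - m i⟫ - σ * ⟪g, z i⟫ := by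
      rw [← sub_sub, inner_sub_right, inner_smul_right]
    rw [this]
    field_simp
    ring
  rw [e1, abs_mul, abs_div, abs_of_pos hσ]
  have h3 : |⟪z i, w⟫| ≤ ‖z‖ * ‖w‖ := (abs_real_inner_le_norm _ _).trans (by gcongr)
  have h4 : |(J i b - J i (deviate b i (m i)) - ⟪g, b i - m i⟫) + ⟪g, b i - (m i + σ • z i)⟫| ≤
      L * (σ * ‖z‖) * (σ * ‖z‖) + B * (2 * (σ * ‖z‖) * (σ / (r * ρ) * ‖z‖) ^ k) := by
    refine (abs_add_le _ _).trans (add_le_add (h1.trans ?_) ?_)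
    · have := hG.L_nonneg
      gcongr
    · have := hG.B_nonneg
      exact (abs_real_inner_le_norm _ _).trans (by gcongr)
  refine (mul_le_mul (div_le_div_of_nonneg_right h4 hσ.le) h3 (abs_nonneg _) ?_).trans (le_of_eq ?_)
  · have := hG.L_nonneg; have := hG.B_nonneg; have := hG.r_pos
    positivity
  · rw [mul_pow]
    field_simp
    ring

lemma GameBounds.integrable_div_mul_inner (hG : GameBounds A J r L B R) {σ : ℝ} (hσ : 0 < σ)
    (i : Fin N) (w : Action d)
    (f : Joint N d → ℝ) (hf : Continuous f) (hfB : ∀ z, |f z| ≤ B) :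
    Integrable (fun z : Joint N d => f z / σ * ⟪z i, w⟫) (stdGaussian (Joint N d)) := by
  have hint : Integrable (fun z : Joint N d => ‖z‖ * ‖w‖) (stdGaussian (Joint N d)) := by
    simpa using (integrable_norm_pow_stdGaussian (E := Joint N d) 1).mul_const ‖w‖
  refine (hint.const_mul (B / σ)).mono' (by fun_prop) (ae_of_all _ fun z => ?_)
  rw [Real.norm_eq_abs, abs_mul, abs_div, abs_of_pos hσ]
  have := hG.B_nonneg
  exact mul_le_mul (div_le_div_of_nonneg_right (hfB z) hσ.le) (abs_block_inner_le z i w)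
    (abs_nonneg _) (by positivity)

/-- The bias of the one-point gradient estimate. -/
lemma GameBounds.abs_bias_le (hG : GameBounds A J r L B R) {ρ σ : ℝ} (hρ0 : 0 < ρ) (hρ1 : ρ ≤ 1)
    (hσ : 0 < σ)
    {m : Joint N d} (hm : ∀ i, m i ∈ (1 - ρ) • A i) (i : Fin N) (k : ℕ) (w : Action d) :
    |(∫ z, J i (jointProj A (m + σ • z)) / σ * ⟪z i, w⟫ ∂(stdGaussian (Joint N d)))
        - ⟪pseudoGradient J m i, w⟫| ≤
      ‖w‖ * (L * σ * gaussMoment N d 3 + 2 * B * (σ / (r * ρ)) ^ k * gaussMoment N d (k + 2)) := by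
  have hmA : m ∈ jointSet A := fun j =>
    shrink_subset (hG.convex j) (hG.zero_mem j) hρ0.le hρ1 (hm j)
  have hdev : Continuous fun z : Joint N d => deviate (jointProj A (m + σ • z)) i (m i) := by
    unfold deviate
    refine (PiLp.continuous_toLp 2 _).comp (Continuous.update ?_ i continuous_const)
    exact (PiLp.continuous_ofLp 2 _).comp (hG.admissible.continuous_jointProj.comp (by fun_prop))
  have hI1 := hG.integrable_div_mul_inner hσ i w (fun z => J i (jointProj A (m + σ • z)))
    ((hG.continuous_cost i).comp (by fun_prop)) fun z => hG.abs_cost_le i _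
  have hI2 := hG.integrable_div_mul_inner hσ i w
      (fun z => J i (deviate (jointProj A (m + σ • z)) i (m i)))
    ((hG.smooth i).continuous.comp hdev) fun z =>
      hG.cost_le i _ (deviate_mem_jointSet (hG.admissible.jointProj_mem _) (hmA i))
  have hI3 : Integrable (fun z : Joint N d => ⟪pseudoGradient J m i, z i⟫ * ⟪z i, w⟫)
      (stdGaussian (Joint N d)) := by
    refine ((integrable_norm_pow_stdGaussian (E := Joint N d) 2).const_mul
      (‖pseudoGradient J m i‖ * ‖w‖)).mono' (by fun_prop) (ae_of_all _ fun z => ?_)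
    rw [Real.norm_eq_abs, abs_mul]
    calc _ ≤ (‖pseudoGradient J m i‖ * ‖z‖) * (‖z‖ * ‖w‖) := by
          refine mul_le_mul ((abs_real_inner_le_norm _ _).trans ?_) (abs_block_inner_le z i w)
              (abs_nonneg _)
            (by positivity)
          gcongr; exact norm_block_le z i
      _ = _ := by ring
  -- The projection acts block by block, so the deviated payoff does not see `z i` and the integrand
  -- is odd in that block.
  have hz : ∫ z, J i (deviate (jointProj A (m + σ • z)) i (m i)) / σ * ⟪z i, w⟫
      ∂(stdGaussian (Joint N d)) = 0 := by
    refine integral_eq_zero_of_flipBlock i fun z => ?_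
    have : deviate (jointProj A (m + σ • flipBlock i z)) i (m i) =
        deviate (jointProj A (m + σ • z)) i (m i) := by
      ext1 j
      by_cases h : j = i
      · subst h; simp
      · simp [deviate_of_ne, flipBlock_of_ne, h]
    rw [this, flipBlock_same, inner_neg_left, mul_neg]
  have hkey : (∫ z, J i (jointProj A (m + σ • z)) / σ * ⟪z i, w⟫ ∂(stdGaussian (Joint N d)))
        - ⟪pseudoGradient J m i, w⟫ = ∫ z, (J i (jointProj A (m + σ • z)) / σ * ⟪z i, w⟫
        - J i (deviate (jointProj A (m + σ • z)) i (m i)) / σ * ⟪z i, w⟫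
        - ⟪pseudoGradient J m i, z i⟫ * ⟪z i, w⟫) ∂(stdGaussian (Joint N d)) := by
    have e1 := integral_sub (hI1.sub hI2) hI3
    simp only [Pi.sub_apply] at e1
    rw [e1, integral_sub hI1 hI2, hz, integral_block_inner_mul_inner, sub_zero]
  have hI4 := (integrable_norm_pow_stdGaussian (E := Joint N d) 3).const_mul (L * σ)
  have hI5 := (integrable_norm_pow_stdGaussian (E := Joint N d) (k + 2)).const_mul
    (2 * B * (σ / (r * ρ)) ^ k)
  rw [hkey, ← Real.norm_eq_abs]
  refine (norm_integral_le_of_norm_le ((hI4.add hI5).const_mul ‖w‖)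
    (ae_of_all _ fun z => hG.abs_expansion_le hρ0 hρ1 hσ hm i k z w)).trans (le_of_eq ?_)
  rw [integral_const_mul, integral_add' hI4 hI5, integral_const_mul, integral_const_mul]
  rfl

end

/-! ### One step of the algorithm -/

/-- The one-point estimate of the pseudo-gradient at `m` given the sample `x`. -/
def gradEstimate (A : Fin N → Set (Action d)) (J : Fin N → Joint N d → ℝ) (σ : ℝ)
    (m x : Joint N d) : Joint N d :=
  WithLp.toLp 2 fun i => (J i (jointProj A x) / σ ^ 2) • (x i - m i)

lemma gradEstimate_add_smul (A : Fin N → Set (Action d)) (J : Fin N → Joint N d → ℝ) {σ : ℝ}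
    (hσ : 0 < σ) (m z : Joint N d) (i : Fin N) :
    gradEstimate A J σ m (m + σ • z) i = (J i (jointProj A (m + σ • z)) / σ) • z i := by
  simp only [gradEstimate, PiLp.add_apply, PiLp.smul_apply, add_sub_cancel_left, smul_smul]
  congr 1
  field_simp

section
variable {A : Fin N → Set (Action d)} {J : Fin N → Joint N d → ℝ} {r L B R : ℝ}

lemma GameBounds.continuous_gradEstimate (hG : GameBounds A J r L B R) (σ : ℝ) :
    Continuous fun q : Joint N d × Joint N d => gradEstimate A J σ q.1 q.2 := by
  unfold gradEstimate
  refine (PiLp.continuous_toLp 2 _).comp (continuous_pi fun i => ?_)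
  have h := (hG.continuous_cost i).comp (continuous_snd (X := Joint N d) (Y := Joint N d))
  refine Continuous.smul (h.div_const _) ?_
  fun_prop

lemma GameBounds.norm_gradEstimate_sq_le (hG : GameBounds A J r L B R) {σ : ℝ} (hσ : 0 < σ)
    (m z : Joint N d) :
    ‖gradEstimate A J σ m (m + σ • z)‖ ^ 2 ≤ (B / σ) ^ 2 * ‖z‖ ^ 2 := by
  rw [joint_norm_sq, joint_norm_sq z, Finset.mul_sum]
  refine Finset.sum_le_sum fun i _ => ?_
  rw [gradEstimate_add_smul A J hσ, norm_smul, mul_pow, Real.norm_eq_abs, abs_div, abs_of_pos hσ]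
  have := hG.abs_cost_le i (m + σ • z)
  gcongr

/-- Expanding the square leaves a cross term, handled by the bias bound summed over the `N` players,
and a second moment, handled by boundedness of the payoffs. The order `k` stays free until the
schedules are known. -/
lemma GameBounds.integral_step_le (hG : GameBounds A J r L B R) {ρ σ : ℝ} (hρ0 : 0 < ρ)
    (hρ1 : ρ ≤ 1) (hσ : 0 < σ)
    {m : Joint N d} (hm : ∀ i, m i ∈ (1 - ρ) • A i) (k : ℕ) {γ : ℝ} (hγ : 0 ≤ γ)
    (p : Joint N d) :
    ∫⁻ z, ENNReal.ofReal (‖m - γ • gradEstimate A J σ m (m + σ • z) - p‖ ^ 2)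
        ∂(stdGaussian (Joint N d)) ≤
      ENNReal.ofReal (‖m - p‖ ^ 2 - 2 * γ * ⟪pseudoGradient J m, m - p⟫
        + 2 * γ * (N * (L * σ * gaussMoment N d 3
          + 2 * B * (σ / (r * ρ)) ^ k * gaussMoment N d (k + 2))) * ‖m - p‖
        + γ ^ 2 * ((B / σ) ^ 2 * gaussMoment N d 2)) := by
  set v := m - p with hv
  set β := L * σ * gaussMoment N d 3 + 2 * B * (σ / (r * ρ)) ^ k * gaussMoment N d (k + 2) with hβ
  set e : Joint N d → Joint N d := fun z => gradEstimate A J σ m (m + σ • z) with he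
  have hβ0 : 0 ≤ β := by
    have := hG.L_nonneg; have := hG.B_nonneg; have := hG.r_pos
    have := gaussMoment_nonneg (N := N) (d := d) 3
    have := gaussMoment_nonneg (N := N) (d := d) (k + 2)
    positivity
  have hmz : Continuous fun z : Joint N d => (m, m + σ • z) := by fun_prop
  have hec : Continuous e := by
    have h := (hG.continuous_gradEstimate σ).comp hmz
    simpa only [Function.comp_def] using h
  have hinner : ∀ z, ⟪e z, v⟫ = ∑ i, J i (jointProj A (m + σ • z)) / σ * ⟪z i, v i⟫ := fun z => by
    rw [joint_inner]
    have h : ∀ i, e z i = (J i (jointProj A (m + σ • z)) / σ) • z i :=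
      gradEstimate_add_smul A J hσ m z
    simp_rw [h, real_inner_smul_left]
  have hIi : ∀ i, Integrable (fun z : Joint N d =>
      J i (jointProj A (m + σ • z)) / σ * ⟪z i, v i⟫) (stdGaussian (Joint N d)) := fun i =>
    hG.integrable_div_mul_inner hσ i (v i) (fun z => J i (jointProj A (m + σ • z)))
      ((hG.continuous_cost i).comp (by fun_prop)) fun z => hG.abs_cost_le i _
  have hI1 : Integrable (fun z => ⟪e z, v⟫) (stdGaussian (Joint N d)) := by
    simp_rw [hinner]
    exact integrable_finsetSum _ fun i _ => hIi i
  have hdom := (integrable_norm_pow_stdGaussian (E := Joint N d) 2).const_mul ((B / σ) ^ 2)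
  have hI2 : Integrable (fun z => ‖e z‖ ^ 2) (stdGaussian (Joint N d)) := by
    refine hdom.mono' (by fun_prop) (ae_of_all _ fun z => ?_)
    rw [Real.norm_of_nonneg (by positivity)]
    exact hG.norm_gradEstimate_sq_le hσ m z
  have hexp : ∀ z, ‖m - γ • e z - p‖ ^ 2 =
      ‖v‖ ^ 2 - 2 * γ * ⟪e z, v⟫ + γ ^ 2 * ‖e z‖ ^ 2 := fun z => by
    have : m - γ • e z - p = v - γ • e z := by rw [hv]; abel
    rw [this, norm_sub_sq_real, inner_smul_right, norm_smul, mul_pow, Real.norm_eq_abs, sq_abs,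
      real_inner_comm]
    ring
  have hI3 : Integrable (fun z => ‖v‖ ^ 2 - 2 * γ * ⟪e z, v⟫) (stdGaussian (Joint N d)) :=
    (integrable_const _).sub (hI1.const_mul _)
  have hI : Integrable (fun z => ‖m - γ • e z - p‖ ^ 2) (stdGaussian (Joint N d)) := by
    simp_rw [hexp]
    exact hI3.add (hI2.const_mul _)
  change ∫⁻ z, ENNReal.ofReal (‖m - γ • e z - p‖ ^ 2) ∂(stdGaussian (Joint N d)) ≤ _
  rw [← ofReal_integral_eq_lintegral_ofReal hI (ae_of_all _ fun z => sq_nonneg _)]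
  apply ENNReal.ofReal_le_ofReal
  simp_rw [hexp]
  rw [integral_add hI3 (hI2.const_mul _), integral_sub (integrable_const _) (hI1.const_mul _),
    integral_const_mul, integral_const_mul]
  have hb : |(∫ z, ⟪e z, v⟫ ∂(stdGaussian (Joint N d))) - ⟪pseudoGradient J m, v⟫| ≤
      N * β * ‖v‖ := by
    simp_rw [hinner]
    rw [integral_finsetSum _ fun i _ => hIi i, joint_inner, ← Finset.sum_sub_distrib]
    refine (Finset.abs_sum_le_sum_abs _ _).trans ?_
    have hbi : ∀ i ∈ Finset.univ, |(∫ z, J i (jointProj A (m + σ • z)) / σ * ⟪z i, v i⟫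
        ∂(stdGaussian (Joint N d))) - ⟪pseudoGradient J m i, v i⟫| ≤ ‖v‖ * β := fun i _ =>
      (hG.abs_bias_le hρ0 hρ1 hσ hm i k (v i)).trans
        (mul_le_mul_of_nonneg_right (norm_block_le v i) hβ0)
    refine (Finset.sum_le_sum hbi).trans (le_of_eq ?_)
    rw [Finset.sum_const, Finset.card_univ, Fintype.card_fin, nsmul_eq_mul]
    ring
  have h2 : ∫ z, ‖e z‖ ^ 2 ∂(stdGaussian (Joint N d)) ≤ (B / σ) ^ 2 * gaussMoment N d 2 := by
    rw [gaussMoment, ← integral_const_mul]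
    exact integral_mono hI2 hdom fun z => hG.norm_gradEstimate_sq_le hσ m z
  simp only [integral_const, probReal_univ, one_smul]
  generalize (∫ z, ⟪e z, v⟫ ∂(stdGaussian (Joint N d))) = I₁ at hb ⊢
  generalize (∫ z, ‖e z‖ ^ 2 ∂(stdGaussian (Joint N d))) = I₂ at h2 ⊢
  generalize ⟪pseudoGradient J m, v⟫ = g at hb ⊢
  generalize (B / σ) ^ 2 * gaussMoment N d 2 = c₂ at h2 ⊢
  have h3 := mul_le_mul_of_nonneg_left (abs_le.1 hb).1 hγ
  have h5 := mul_le_mul_of_nonneg_left h2 (sq_nonneg γ)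
  generalize (N : ℝ) * β = b at h3 ⊢
  linarith

/-- The drift towards the (shrunk) solution of the variational inequality. -/
lemma GameBounds.drift_ge (hG : GameBounds A J r L B R) {ν : ℝ}
    (hM : StronglyMonotone ν (pseudoGradient J))
    {a : Joint N d} (ha : a ∈ jointSet A) (hvi : ∀ y ∈ jointSet A, 0 ≤ ⟪pseudoGradient J a, y - a⟫)
    {ρ ρ' : ℝ} (hρ0 : 0 ≤ ρ) (hρρ' : ρ ≤ ρ') (hρ'1 : ρ' ≤ 1) {m : Joint N d}
    (hm : ∀ i, m i ∈ (1 - ρ') • A i) :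
    ν * ‖m - (1 - ρ) • a‖ ^ 2 - L * R * ρ * ‖m - (1 - ρ) • a‖ - B * R * (ρ' - ρ) ≤
      ⟪pseudoGradient J m, m - (1 - ρ) • a⟫ := by
  set p := (1 - ρ) • a with hp
  have hpA : p ∈ jointSet A := fun i =>
    shrink_subset (hG.convex i) (hG.zero_mem i) hρ0 (hρρ'.trans hρ'1)
      (Set.smul_mem_smul_set (ha i))
  choose y hy hym using fun i => Set.mem_smul_set.1 (hm i)
  have hmy : m = (1 - ρ') • (WithLp.toLp 2 y : Joint N d) := by
    ext1 i
    exact (hym i).symm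
  have h1 := hM m p
  -- The state lies in the set shrunk by the previous `ρ'`, while the target uses the new `ρ`. The
  -- variational inequality applies to `y - a`, and the mismatch costs only `ρ' - ρ`.
  have h2 : m - p = (1 - ρ') • ((WithLp.toLp 2 y : Joint N d) - a) - (ρ' - ρ) • a := by
    rw [hmy, hp]
    module
  have h3 : -(B * R * (ρ' - ρ)) ≤ ⟪pseudoGradient J a, m - p⟫ := by
    rw [h2, inner_sub_right, inner_smul_right, inner_smul_right]
    have h4 := mul_nonneg (sub_nonneg.2 hρ'1) (hvi (WithLp.toLp 2 y) hy)
    have h5 : ⟪pseudoGradient J a, a⟫ ≤ B * R :=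
      (real_inner_le_norm _ _).trans (mul_le_mul (hG.grad_le a ha) (hG.norm_le a ha)
        (norm_nonneg _) hG.B_nonneg)
    have h6 := mul_le_mul_of_nonneg_left h5 (sub_nonneg.2 hρρ')
    linarith
  have h4 : -(L * R * ρ * ‖m - p‖) ≤ ⟪pseudoGradient J p - pseudoGradient J a, m - p⟫ := by
    have h5 : ‖pseudoGradient J p - pseudoGradient J a‖ ≤ L * R * ρ := by
      refine (hG.lipschitz p hpA a ha).trans ?_
      have : p - a = -(ρ • a) := by rw [hp]; module
      rw [this, norm_neg, norm_smul, Real.norm_of_nonneg hρ0, mul_assoc, mul_comm R]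
      have := hG.L_nonneg
      have := hG.norm_le a ha
      gcongr
    have h6 := (abs_le.1 (abs_real_inner_le_norm (pseudoGradient J p - pseudoGradient J a)
      (m - p))).1
    have h7 := mul_le_mul_of_nonneg_right h5 (norm_nonneg (m - p))
    linarith
  have h5 : ⟪pseudoGradient J m, m - p⟫ = ⟪pseudoGradient J m - pseudoGradient J p, m - p⟫
      + ⟪pseudoGradient J p - pseudoGradient J a, m - p⟫ + ⟪pseudoGradient J a, m - p⟫ := by
    rw [← inner_add_left, ← inner_add_left]
    congr 1
    abel
  linarith

end

/-- The recursion for the squared distances, with `V` the distance to the new target, `W` the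
distance to the old one. -/
lemma recursion_arith {ν t V W q Δ C E inn R T S : ℝ} (hν : 0 < ν) (ht : 4 ≤ t) (hV : 0 ≤ V)
    (hVW : V ≤ W + R * Δ)
    (hinn : ν * V ^ 2 - T * V - S * Δ ≤ inn)
    (hE : E = V ^ 2 - 2 * (4 / (ν * t)) * inn + 2 * (4 / (ν * t)) * q * V + (4 / (ν * t)) ^ 2 * C) :
    E ≤ (1 - 2 / t) * W ^ 2 + (4 * (T + q) ^ 2 / (ν ^ 2 * t) + 8 * S * Δ / (ν * t)
      + 16 * C / (ν ^ 2 * t ^ 2) + 2 * t * R ^ 2 * Δ ^ 2) := by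
  have ht0 : 0 < t := by linarith
  have hγ : 0 < 4 / (ν * t) := by positivity
  have h1 : E ≤ (1 - 4 / t) * V ^ 2 + 4 * (T + q) ^ 2 / (ν ^ 2 * t) + 8 * S * Δ / (ν * t)
      + 16 * C / (ν ^ 2 * t ^ 2) := by
    have h2 := mul_le_mul_of_nonneg_left hinn hγ.le
    -- Completing the square absorbs the terms linear in `V`. It spends half of the contraction `8 /
    -- t` produced by the drift with step `4 / (ν * t)`.
    have h3 : 0 ≤ 4 / (ν ^ 2 * t) * (ν * V - (T + q)) ^ 2 := by positivity
    have e1 : 4 / (ν ^ 2 * t) * (ν * V - (T + q)) ^ 2 = 4 / t * V ^ 2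
        - 2 * (4 / (ν * t)) * (T + q) * V + 4 * (T + q) ^ 2 / (ν ^ 2 * t) := by
      field_simp; ring
    have e2 : 4 / (ν * t) * (ν * V ^ 2 - T * V - S * Δ) = 4 / t * V ^ 2
        - 4 / (ν * t) * T * V - 4 * S * Δ / (ν * t) := by
      field_simp
    have e3 : (4 / (ν * t)) ^ 2 * C = 16 * C / (ν ^ 2 * t ^ 2) := by field_simp; ring
    have e4 : 8 * S * Δ / (ν * t) = 2 * (4 * S * Δ / (ν * t)) := by ring
    rw [hE, e3, e4]
    linarith
  -- Young's inequality with weight `1 / t`: moving the target costs another `1 / t` of contraction,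
  -- and a factor `t` on the squared displacement, affordable since `Δ` is of order `t ^ (-1 - p)`.
  have h2 : V ^ 2 ≤ (1 + 1 / t) * W ^ 2 + (1 + t) * (R * Δ) ^ 2 := by
    have h3 : V ^ 2 ≤ (W + R * Δ) ^ 2 := pow_le_pow_left₀ hV hVW 2
    have h4 : 0 ≤ 1 / t * (W - t * (R * Δ)) ^ 2 := by positivity
    have e1 : 1 / t * (W - t * (R * Δ)) ^ 2 = 1 / t * W ^ 2 - 2 * W * (R * Δ) + t * (R * Δ) ^ 2 := by
      field_simp
      ring
    nlinarith
  have h40 : 0 ≤ 1 - 4 / t := by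
    rw [sub_nonneg, div_le_one ht0]; exact ht
  have h3 := mul_le_mul_of_nonneg_left h2 h40
  have h5 : (1 - 4 / t) * ((1 + 1 / t) * W ^ 2) ≤ (1 - 2 / t) * W ^ 2 := by
    rw [← mul_assoc]
    refine mul_le_mul_of_nonneg_right ?_ (sq_nonneg _)
    have : (1 - 4 / t) * (1 + 1 / t) = 1 - 3 / t - 4 / t ^ 2 := by field_simp; ring
    rw [this]
    have h6 : 0 ≤ 4 / t ^ 2 := by positivity
    have h7 : 2 / t ≤ 3 / t := by gcongr; norm_num
    linarith
  have h6 : (1 - 4 / t) * ((1 + t) * (R * Δ) ^ 2) ≤ 2 * t * R ^ 2 * Δ ^ 2 := by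
    have h7 : (1 - 4 / t) * ((1 + t) * (R * Δ) ^ 2) ≤ 1 * ((1 + t) * (R * Δ) ^ 2) := by
      refine mul_le_mul_of_nonneg_right ?_ (by positivity)
      have : 0 ≤ 4 / t := by positivity
      linarith
    have h8 : (1 + t) * (R * Δ) ^ 2 ≤ 2 * t * (R * Δ) ^ 2 := by gcongr; linarith
    rw [mul_pow] at h7 h8 ⊢
    linarith
  rw [mul_add] at h3
  linarith

/-! ### Rates -/

/-- With `s = (y + 1) ^ (-p)`, the difference is `s * (((y + 1) / y) ^ p - 1)`, at most `s / y`
because `p ≤ 1`. It bounds the displacement of the shrunk target. -/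
lemma inv_rpow_sub_inv_rpow_le {p y : ℝ} (hp1 : p ≤ 1) (hy : 1 ≤ y) :
    1 / y ^ p - 1 / (y + 1) ^ p ≤ 2 * (y + 1) ^ (-p) / (y + 1) := by
  have hy0 : 0 < y := by linarith
  have hx0 : 0 < y + 1 := by linarith
  set s := (y + 1) ^ (-p) with hs
  have hs0 : 0 < s := Real.rpow_pos_of_pos hx0 _
  have e1 : 1 / (y + 1) ^ p = s := by rw [hs, Real.rpow_neg hx0.le, one_div]
  have e2 : 1 / y ^ p = s * ((y + 1) / y) ^ p := by
    rw [Real.div_rpow hx0.le hy0.le, hs, Real.rpow_neg hx0.le]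
    have := (Real.rpow_pos_of_pos hx0 p).ne'
    field_simp
  have h1 : ((y + 1) / y) ^ p ≤ (y + 1) / y := by
    have h : (1 : ℝ) ≤ (y + 1) / y := by rw [one_le_div hy0]; linarith
    simpa using Real.rpow_le_rpow_of_exponent_le h hp1
  rw [e1, e2]
  have h2 : s * ((y + 1) / y) ^ p ≤ s * ((y + 1) / y) := by gcongr
  have h3 : s * ((y + 1) / y) = s + s / y := by field_simp
  have h4 : s / y ≤ 2 * s / (y + 1) := by
    rw [div_le_div_iff₀ hy0 hx0]
    nlinarith
  linarith

/-- Induction, with `x = n + 1`. Once `K ≥ C`, the error uses up one of the two units of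
contraction, leaving `K * x ^ (-q) * (1 - 1 / x)`. This is at most `K * (x + 1) ^ (-q)` because `q ≤
1`. -/
lemma le_rpow_of_recursion {e : ℕ → ℝ} {q C : ℝ} (hq1 : q ≤ 1) {n₀ : ℕ}
    (hn₀ : 1 ≤ n₀)
    (h : ∀ n : ℕ, n₀ ≤ n → e (n + 1) ≤ (1 - 2 / ((n : ℝ) + 1)) * e n
      + C * ((n : ℝ) + 1) ^ (-(1 + q))) :
    ∃ K : ℝ, ∀ n : ℕ, n₀ ≤ n → e n ≤ K * ((n : ℝ) + 1) ^ (-q) := by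
  set K := max (max C 0) (e n₀ * ((n₀ : ℝ) + 1) ^ q) with hK
  have hK0 : 0 ≤ K := (le_max_right C 0).trans (le_max_left _ _)
  have hKC : C ≤ K := (le_max_left C 0).trans (le_max_left _ _)
  refine ⟨K, fun n hn => ?_⟩
  induction n, hn using Nat.le_induction with
  | base =>
    have hx : (0 : ℝ) < (n₀ : ℝ) + 1 := by positivity
    rw [Real.rpow_neg hx.le, ← div_eq_mul_inv, le_div_iff₀ (Real.rpow_pos_of_pos hx _)]
    exact le_max_right _ _
  | succ n hn ih =>
    set x : ℝ := (n : ℝ) + 1 with hx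
    have hn1 : (1 : ℝ) ≤ n := by exact_mod_cast hn₀.trans hn
    have hx2 : 2 ≤ x := by rw [hx]; linarith
    have hx0 : 0 < x := by linarith
    have hs0 : 0 < x ^ (-q) := Real.rpow_pos_of_pos hx0 _
    have e1 : x ^ (-(1 + q)) = x ^ (-q) / x := by
      rw [neg_add, Real.rpow_add hx0, Real.rpow_neg_one]; ring
    have hcoef : 0 ≤ 1 - 2 / x := by
      rw [sub_nonneg, div_le_one hx0]; exact hx2
    have h1 := h n hn
    rw [e1] at h1
    have h2 := mul_le_mul_of_nonneg_left ih hcoef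
    have h3 : C * (x ^ (-q) / x) ≤ K * (x ^ (-q) / x) := by gcongr
    have h4 : x ^ (-q) * (1 - 1 / x) ≤ (x + 1) ^ (-q) := by
      have hx1 : 0 < x + 1 := by linarith
      have h5 : x / (x + 1) ≤ (x / (x + 1)) ^ q := by
        have h6 : x / (x + 1) ≤ 1 := by rw [div_le_one hx1]; linarith
        simpa using Real.rpow_le_rpow_of_exponent_ge (by positivity) h6 hq1
      have h6 : 1 - 1 / x ≤ x / (x + 1) := by
        rw [sub_le_iff_le_add, div_add_div _ _ hx1.ne' hx0.ne', one_le_div (by positivity)]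
        nlinarith
      have e2 : x ^ (-q) * (x / (x + 1)) ^ q = (x + 1) ^ (-q) := by
        rw [Real.div_rpow hx0.le hx1.le, Real.rpow_neg hx0.le, Real.rpow_neg hx1.le]
        have := (Real.rpow_pos_of_pos hx0 q).ne'
        field_simp
      rw [← e2]
      gcongr
      exact h6.trans h5
    have h5 := mul_le_mul_of_nonneg_left h4 hK0
    have e3 : (1 - 2 / x) * (K * x ^ (-q)) + K * (x ^ (-q) / x) = K * (x ^ (-q) * (1 - 1 / x)) := by
      field_simp; ring
    push_cast
    rw [← hx]
    linarith

/-- The parameters of the algorithm at the times `y` and `y + 1`. -/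
lemma error_terms_le {ν c ε r L B R m₂ m₃ mₖ y : ℝ} (n k : ℕ) (hν : 0 < ν) (hc : 0 < c)
    (hε : 0 < ε) (hε' : ε < 1 / 4) (hr : 0 < r) (hL : 0 ≤ L) (hB : 0 ≤ B) (hR : 0 ≤ R)
    (hm₂ : 0 ≤ m₂) (hm₃ : 0 ≤ m₃) (hmₖ : 0 ≤ mₖ) (hk : 1 / 4 ≤ ε * k) (hy : 1 ≤ y)
    {σ ρ ρ' : ℝ} (hσ : σ = c / (y + 1) ^ (1 / 4 : ℝ)) (hρ : ρ = 1 / (y + 1) ^ (1 / 4 - ε))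
    (hρ' : ρ' = 1 / y ^ (1 / 4 - ε)) :
    4 * (L * R * ρ + n * (L * σ * m₃ + 2 * B * (σ / (r * ρ')) ^ k * mₖ)) ^ 2 / (ν ^ 2 * (y + 1))
      + 8 * (B * R) * (ρ' - ρ) / (ν * (y + 1))
      + 16 * ((B / σ) ^ 2 * m₂) / (ν ^ 2 * (y + 1) ^ 2) + 2 * (y + 1) * R ^ 2 * (ρ' - ρ) ^ 2 ≤
    (4 * (L * R + n * (L * c * m₃ + 2 * B * (c / r) ^ k * mₖ)) ^ 2 / ν ^ 2 + 16 * (B * R) / ν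
      + 16 * (B ^ 2 * m₂) / (ν ^ 2 * c ^ 2) + 8 * R ^ 2)
      * (y + 1) ^ (-(1 + 2 * (1 / 4 - ε))) := by
  set p := 1 / 4 - ε with hp
  have hp0 : 0 < p := by rw [hp]; linarith
  have hp4 : p ≤ 1 / 4 := by rw [hp]; linarith
  have hy0 : 0 < y := by linarith
  have hx0 : 0 < y + 1 := by linarith
  have hx1 : 1 ≤ y + 1 := by linarith
  have hρle : ρ ≤ ρ' := by
    rw [hρ, hρ']
    gcongr
    linarith
  have hΔ : ρ' - ρ ≤ 2 * (y + 1) ^ (-p) / (y + 1) := by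
    rw [hρ, hρ']
    exact inv_rpow_sub_inv_rpow_le (by linarith) hy
  have hρ'pos : 0 < ρ' := by rw [hρ']; positivity
  have hσ0 : 0 < σ := by rw [hσ]; positivity
  -- The shrinking decays more slowly than the noise by the factor `t ^ ε`; this is the role of `ε >
  -- 0`.
  have hquot : σ / (r * ρ') ≤ c / r * (y + 1) ^ (-ε) := by
    have e1 : σ / (r * ρ') = c / r * (y ^ p / (y + 1) ^ (1 / 4 : ℝ)) := by
      rw [hσ, hρ']
      have := (Real.rpow_pos_of_pos hy0 p).ne'
      field_simp
    have e2 : (y + 1) ^ (-ε) = (y + 1) ^ p / (y + 1) ^ (1 / 4 : ℝ) := by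
      rw [← Real.rpow_sub hx0, hp]; congr 1; ring
    rw [e1, e2]
    gcongr
    linarith
  set x := y + 1 with hx
  set s := x ^ (-p) with hs
  have hs0 : 0 < s := Real.rpow_pos_of_pos hx0 _
  have hρs : ρ = s := by rw [hρ, hs, Real.rpow_neg hx0.le, one_div]
  have hq4 : x ^ (-(1 / 4 : ℝ)) ≤ s := Real.rpow_le_rpow_of_exponent_le hx1 (by linarith)
  have hσs : σ ≤ c * s := by
    rw [hσ, div_eq_mul_inv, ← Real.rpow_neg hx0.le]
    gcongr
  have hpow : (σ / (r * ρ')) ^ k ≤ (c / r) ^ k * s := by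
    refine (pow_le_pow_left₀ (by positivity) hquot k).trans ?_
    rw [mul_pow]
    gcongr
    rw [← Real.rpow_natCast, ← Real.rpow_mul hx0.le]
    refine (Real.rpow_le_rpow_of_exponent_le hx1 ?_).trans hq4
    linarith
  -- The variance grows like `x ^ (1 / 2)`, and `x * s ^ 2 = x ^ (1 - 2 * p)` dominates it because
  -- `p ≤ 1 / 4`.
  have hinvσ : (B / σ) ^ 2 ≤ B ^ 2 / c ^ 2 * (x * s ^ 2) := by
    have e1 : (B / σ) ^ 2 = B ^ 2 / c ^ 2 * (x ^ (1 / 4 : ℝ)) ^ 2 := by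
      rw [hσ]
      have := (Real.rpow_pos_of_pos hx0 (1 / 4)).ne'
      field_simp
    rw [e1]
    gcongr
    have e2 : x * s ^ 2 = x ^ (1 - 2 * p) := by
      rw [hs, ← Real.rpow_natCast, ← Real.rpow_mul hx0.le]
      nth_rewrite 1 [← Real.rpow_one x]
      rw [← Real.rpow_add hx0]
      congr 1; push_cast; ring
    rw [e2, ← Real.rpow_natCast, ← Real.rpow_mul hx0.le]
    refine Real.rpow_le_rpow_of_exponent_le hx1 ?_
    push_cast
    linarith
  have hxs : 1 / x ≤ s := by
    rw [one_div, ← Real.rpow_neg_one]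
    exact Real.rpow_le_rpow_of_exponent_le hx1 (by linarith)
  have hfin : x ^ (-(1 + 2 * p)) = s ^ 2 / x := by
    rw [hs, ← Real.rpow_natCast, ← Real.rpow_mul hx0.le, div_eq_mul_inv, ← Real.rpow_neg_one,
      ← Real.rpow_add hx0]
    congr 1; push_cast; ring
  set Q := L * R + n * (L * c * m₃ + 2 * B * (c / r) ^ k * mₖ) with hQ
  have hT : L * R * ρ + n * (L * σ * m₃ + 2 * B * (σ / (r * ρ')) ^ k * mₖ) ≤ Q * s := by
    have : Q * s = L * R * s + n * (L * (c * s) * m₃ + 2 * B * ((c / r) ^ k * s) * mₖ) := by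
      rw [hQ]; ring
    rw [this, hρs]
    gcongr
  have hT0 : 0 ≤ L * R * ρ + n * (L * σ * m₃ + 2 * B * (σ / (r * ρ')) ^ k * mₖ) := by
    rw [hρs]; positivity
  have hΔ0 : 0 ≤ ρ' - ρ := sub_nonneg.2 hρle
  have t1 : 4 * (L * R * ρ + n * (L * σ * m₃ + 2 * B * (σ / (r * ρ')) ^ k * mₖ)) ^ 2
      / (ν ^ 2 * x) ≤ 4 * Q ^ 2 / ν ^ 2 * (s ^ 2 / x) := by
    have : 4 * Q ^ 2 / ν ^ 2 * (s ^ 2 / x) = 4 * (Q * s) ^ 2 / (ν ^ 2 * x) := by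
      field_simp
    rw [this]
    gcongr
  have t2 : 8 * (B * R) * (ρ' - ρ) / (ν * x) ≤ 16 * (B * R) / ν * (s ^ 2 / x) := by
    have h1 : ρ' - ρ ≤ 2 * s * s := by
      refine hΔ.trans ?_
      rw [div_eq_mul_one_div]
      gcongr
    have : 16 * (B * R) / ν * (s ^ 2 / x) = 8 * (B * R) * (2 * s * s) / (ν * x) := by
      field_simp; ring
    rw [this]
    gcongr
  have t3 : 16 * ((B / σ) ^ 2 * m₂) / (ν ^ 2 * x ^ 2) ≤
      16 * (B ^ 2 * m₂) / (ν ^ 2 * c ^ 2) * (s ^ 2 / x) := by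
    have : 16 * (B ^ 2 * m₂) / (ν ^ 2 * c ^ 2) * (s ^ 2 / x) =
        16 * (B ^ 2 / c ^ 2 * (x * s ^ 2) * m₂) / (ν ^ 2 * x ^ 2) := by
      field_simp
    rw [this]
    gcongr
  have t4 : 2 * x * R ^ 2 * (ρ' - ρ) ^ 2 ≤ 8 * R ^ 2 * (s ^ 2 / x) := by
    have : 8 * R ^ 2 * (s ^ 2 / x) = 2 * x * R ^ 2 * (2 * s / x) ^ 2 := by
      field_simp; ring
    rw [this]
    gcongr
  rw [hfin]
  linarith

/-! ### Almost sure convergence of almost supermartingales -/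

/-- The partial sums of `b` minus `D` form an `L¹`-bounded submartingale, so `D` converges almost
surely. Convergence of the means gives a subsequence tending to zero almost surely, which identifies
the limit. -/
lemma ae_tendsto_zero_of_almost_supermartingale {Ω : Type*} {m0 : MeasurableSpace Ω}
    {P : Measure Ω} [IsProbabilityMeasure P] {ℱ : Filtration ℕ m0} {D : ℕ → Ω → ℝ}
    (hadp : StronglyAdapted ℱ D) (hD0 : ∀ n ω, 0 ≤ D n ω) {K : ℝ} (hDK : ∀ n ω, D n ω ≤ K)
    {b : ℕ → ℝ} (hb0 : ∀ n, 0 ≤ b n) (hb : Summable b)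
    (h : ∀ n S, MeasurableSet[ℱ n] S →
      ∫ ω in S, D (n + 1) ω ∂P ≤ ∫ ω in S, D n ω ∂P + b n * P.real S)
    (hE : Tendsto (fun n => ∫ ω, D n ω ∂P) atTop (𝓝 0)) :
    ∀ᵐ ω ∂P, Tendsto (fun n => D n ω) atTop (𝓝 0) := by
  have hDm : ∀ n, StronglyMeasurable (D n) := fun n => (hadp n).mono (ℱ.le n)
  have hDint : ∀ n, Integrable (D n) P := fun n =>
    Integrable.of_bound (hDm n).aestronglyMeasurable K
      (ae_of_all _ fun ω => by rw [Real.norm_of_nonneg (hD0 n ω)]; exact hDK n ω)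
  let W : ℕ → Ω → ℝ := fun n ω => ∑ s ∈ Finset.range n, b s - D n ω
  have hWint : ∀ n, Integrable (W n) P := fun n => (integrable_const _).sub (hDint n)
  have hW : Submartingale W ℱ P := by
    refine submartingale_of_setIntegral_le_succ
      (fun n => stronglyMeasurable_const.sub (hadp n)) hWint fun n S hS => ?_
    simp only [W]
    rw [integral_sub (integrable_const _).integrableOn (hDint n).integrableOn,
      integral_sub (integrable_const _).integrableOn (hDint (n + 1)).integrableOn,
      Finset.sum_range_succ, setIntegral_const, setIntegral_const]
    have := h n S hS
    simp only [smul_eq_mul]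
    linarith
  have hbd : ∀ n, eLpNorm (W n) 1 P ≤ ((∑' s, b s + K).toNNReal : NNReal) := by
    intro n
    have h1 : ∀ᵐ ω ∂P, ‖W n ω‖ ≤ ∑' s, b s + K := ae_of_all _ fun ω => by
      have h2 : ∑ s ∈ Finset.range n, b s ≤ ∑' s, b s :=
        hb.sum_le_tsum _ fun s _ => hb0 s
      have h3 : 0 ≤ ∑ s ∈ Finset.range n, b s := Finset.sum_nonneg fun s _ => hb0 s
      have h4 := hD0 n ω
      have h5 := hDK n ω
      rw [Real.norm_eq_abs, abs_le]
      constructor <;> simp only [W] <;> linarith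
    have := eLpNorm_le_of_ae_bound (p := 1) h1
    simpa [ENNReal.ofReal] using this
  have hmeas : TendstoInMeasure P D atTop (fun _ => (0 : ℝ)) := by
    refine tendstoInMeasure_of_tendsto_eLpNorm (p := 1) one_ne_zero
      (fun n => (hDm n).aestronglyMeasurable) aestronglyMeasurable_const ?_
    have h1 : ∀ n, eLpNorm (D n - fun _ => (0 : ℝ)) 1 P = ENNReal.ofReal (∫ ω, D n ω ∂P) := by
      intro n
      have h2 : (D n - fun _ => (0 : ℝ)) = D n := by ext ω; simp
      rw [h2, eLpNorm_one_eq_lintegral_enorm, ← ofReal_integral_norm_eq_lintegral_enorm (hDint n)]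
      congr 1
      exact integral_congr_ae (ae_of_all _ fun ω => Real.norm_of_nonneg (hD0 n ω))
    simp_rw [h1]
    simpa [Function.comp_def] using (ENNReal.continuous_ofReal.tendsto 0).comp hE
  obtain ⟨ns, hns, hsub⟩ := hmeas.exists_seq_tendsto_ae
  filter_upwards [hW.exists_ae_tendsto_of_bdd hbd, hsub] with ω ⟨l, hl⟩ hω
  have h1 : Tendsto (fun n => D n ω) atTop (𝓝 (∑' s, b s - l)) := by
    have := hb.hasSum.tendsto_sum_nat.sub hl
    simpa [W] using this
  have h2 := tendsto_nhds_unique (h1.comp hns.tendsto_atTop) hω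
  rwa [h2] at h1

/-! ### Runs of the algorithm -/

lemma admissible_smul {A : Fin N → Set (Action d)} (hc : ∀ i, IsCompact (A i))
    (hA : Admissible A) (s : ℝ) : Admissible fun i => s • A i :=
  ⟨fun i => (hA.nonempty i).smul_set, fun i => ((hc i).smul s).isClosed,
    fun i => (hA.convex i).smul s⟩

section
variable {Ω : Type*}

lemma history_mono (μ ξ : ℕ → Ω → Joint N d) : Monotone (history μ ξ) := by
  intro s t hst
  refine sup_le_sup ?_ ?_
  · exact biSup_mono fun u hu => ⟨hu.1, hu.2.trans hst⟩
  · exact biSup_mono fun u hu => ⟨hu.1, hu.2.trans_le hst⟩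

lemma measurable_history (μ ξ : ℕ → Ω → Joint N d) {t : ℕ} (ht : 1 ≤ t) :
    Measurable[history μ ξ t] (μ t) := by
  refine Measurable.mono (comap_measurable (μ t)) ?_ le_rfl
  exact le_sup_of_le_left (le_biSup (fun s => MeasurableSpace.comap (μ s) inferInstance)
    (show t ∈ Set.Icc 1 t from ⟨ht, le_rfl⟩))

/-- The squared distance between the state and the shrunk equilibrium. -/
def sqDist (ρ : ℕ → ℝ) (μ : ℕ → Ω → Joint N d) (b : Joint N d) (n : ℕ) (ω : Ω) : ℝ :=
  ‖μ (n + 1) ω - (1 - ρ n) • b‖ ^ 2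

lemma sqDist_nonneg (ρ : ℕ → ℝ) (μ : ℕ → Ω → Joint N d) (b : Joint N d) (n : ℕ) (ω : Ω) :
    0 ≤ sqDist ρ μ b n ω := sq_nonneg _

lemma measurable_sqDist_history (ρ : ℕ → ℝ) (μ ξ : ℕ → Ω → Joint N d) (b : Joint N d) (n : ℕ) :
    Measurable[history μ ξ (n + 1)] (sqDist ρ μ b n) := by
  have h : Continuous fun x : Joint N d => ‖x - (1 - ρ n) • b‖ ^ 2 := by fun_prop
  exact h.measurable.comp (measurable_history μ ξ (Nat.le_add_left 1 n))

end

section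
variable {A : Fin N → Set (Action d)} {J : Fin N → Joint N d → ℝ} {r L B R : ℝ}
  {Ω : Type*} [mΩ : MeasurableSpace Ω] {P : Measure Ω} {γ σ ρ : ℕ → ℝ} {μ₁ : Joint N d}
  {μ ξ a : ℕ → Ω → Joint N d}

lemma IsOnePointRun.action_eq (hrun : IsOnePointRun P A J γ σ ρ μ₁ μ ξ a) (hA : Admissible A)
    {t : ℕ} (ht : 1 ≤ t) (ω : Ω) : a t ω = jointProj A (ξ t ω) := by
  ext1 i
  exact (hrun.action t ht ω i).unique (hA.convex i)
    (isProj_proj (hA.nonempty i) (hA.isClosed i) (hA.convex i) _)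

lemma IsOnePointRun.isProj_state (hrun : IsOnePointRun P A J γ σ ρ μ₁ μ ξ a) (hA : Admissible A)
    {t : ℕ} (ht : 1 ≤ t) (ω : Ω) (i : Fin N) :
    IsProj ((1 - ρ t) • A i)
      ((μ t ω - γ t • gradEstimate A J (σ t) (μ t ω) (ξ t ω)) i) (μ (t + 1) ω i) := by
  have h := hrun.update t ht ω i
  rw [hrun.action_eq hA ht] at h
  exact h

/-- Measurability of the states is not part of a run. It follows because projections on closed
convex sets are unique and continuous, so each state is a measurable function of the preceding state
and sample. -/
lemma IsOnePointRun.measurable_state (hrun : IsOnePointRun P A J γ σ ρ μ₁ μ ξ a)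
    (hG : GameBounds A J r L B R) {t : ℕ} (ht : 1 ≤ t) : Measurable (μ t) := by
  induction t, ht using Nat.le_induction with
  | base =>
    rw [funext hrun.init]
    exact measurable_const
  | succ t ht ih =>
    have hs := admissible_smul hG.isCompact hG.admissible (1 - ρ t)
    have h1 : μ (t + 1) = fun ω => jointProj (fun i => (1 - ρ t) • A i)
        (μ t ω - γ t • gradEstimate A J (σ t) (μ t ω) (ξ t ω)) := by
      ext1 ω
      ext1 i
      exact (hrun.isProj_state hG.admissible ht ω i).unique (hs.convex i)
        (isProj_proj (hs.nonempty i) (hs.isClosed i) (hs.convex i) _)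
    rw [h1]
    have h2 := (hG.continuous_gradEstimate (σ t)).measurable.comp
      (ih.prodMk (hrun.measurable_sample t ht))
    simp only [Function.comp_def] at h2
    exact hs.continuous_jointProj.measurable.comp (ih.sub (h2.const_smul (γ t)))

lemma IsOnePointRun.history_le (hrun : IsOnePointRun P A J γ σ ρ μ₁ μ ξ a)
    (hG : GameBounds A J r L B R) (t : ℕ) : history μ ξ t ≤ mΩ := by
  refine sup_le (iSup₂_le fun s hs => ?_) (iSup₂_le fun s hs => ?_)
  · exact (hrun.measurable_state hG hs.1).comap_le
  · exact (hrun.measurable_sample s hs.1).comap_le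

/-- The conditional law of the sample, given the history, is Gaussian. -/
lemma IsOnePointRun.setLIntegral_eq [IsProbabilityMeasure P]
    (hrun : IsOnePointRun P A J γ σ ρ μ₁ μ ξ a) (hG : GameBounds A J r L B R) {t : ℕ}
    (ht : 1 ≤ t) (hσ : 0 ≤ σ t) {S : Set Ω} (hS : MeasurableSet[history μ ξ t] S)
    {f : Joint N d × Joint N d → ENNReal} (hf : Measurable f) :
    ∫⁻ ω in S, f (μ t ω, ξ t ω) ∂P =
      ∫⁻ ω in S, ∫⁻ z, f (μ t ω, μ t ω + σ t • z) ∂(stdGaussian (Joint N d)) ∂P := by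
  have hμ := hrun.measurable_state hG ht
  have hξ := hrun.measurable_sample t ht
  have hlaw := map_restrict_eq_of_gaussian_sample (P := P) hμ hξ hσ (S := S)
    -- The history includes the current state, so this intersection is still an event of the past.
    fun C hC B hB => hrun.sample t ht (S ∩ μ t ⁻¹' C)
      (hS.inter (measurable_history μ ξ ht hC)) B hB
  have hφ : Measurable (fun q : Joint N d × Joint N d => (q.1, q.1 + σ t • q.2)) := by fun_prop
  have hfφ : Measurable (fun q : Joint N d × Joint N d => f (q.1, q.1 + σ t • q.2)) := hf.comp hφ
  have h1 := lintegral_map (μ := P.restrict S) hf (hμ.prodMk hξ)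
  rw [← h1, hlaw, lintegral_map hf hφ, lintegral_prod _ hfφ.aemeasurable,
    lintegral_map hfφ.lintegral_prod_right' hμ]

/-- The shrunk target lies in the shrunk set and is fixed by the projection, which is nonexpansive.
The unshrunk `b` need not be fixed, hence the moving target. -/
lemma IsOnePointRun.norm_state_sub_le (hrun : IsOnePointRun P A J γ σ ρ μ₁ μ ξ a)
    (hA : Admissible A) {t : ℕ} (ht : 1 ≤ t) {b : Joint N d} (hb : b ∈ jointSet A) (ω : Ω) :
    ‖μ (t + 1) ω - (1 - ρ t) • b‖ ≤
      ‖μ t ω - γ t • gradEstimate A J (σ t) (μ t ω) (ξ t ω) - (1 - ρ t) • b‖ :=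
  norm_le_of_norm_block_le fun i =>
    (hrun.isProj_state hA ht ω i).norm_sub_le ((hA.convex i).smul _)
      (isProj_self (Set.smul_mem_smul_set (hb i)))

lemma IsOnePointRun.state_mem (hrun : IsOnePointRun P A J γ σ ρ μ₁ μ ξ a)
    {t : ℕ} (ht : 1 ≤ t) (ω : Ω) (i : Fin N) : μ (t + 1) ω i ∈ (1 - ρ t) • A i :=
  (hrun.update t ht ω i).1

lemma IsOnePointRun.state_mem_jointSet (hrun : IsOnePointRun P A J γ σ ρ μ₁ μ ξ a)
    (hG : GameBounds A J r L B R) {t : ℕ} (ht : 1 ≤ t) (hρ0 : 0 ≤ ρ t) (hρ1 : ρ t ≤ 1) (ω : Ω) :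
    μ (t + 1) ω ∈ jointSet A := fun i =>
  shrink_subset (hG.convex i) (hG.zero_mem i) hρ0 hρ1 (hrun.state_mem ht ω i)

lemma IsOnePointRun.sqDist_le (hrun : IsOnePointRun P A J γ σ ρ μ₁ μ ξ a)
    (hG : GameBounds A J r L B R) {t : ℕ} (ht : 1 ≤ t) (hρ0 : 0 ≤ ρ t) (hρ1 : ρ t ≤ 1)
    {b : Joint N d} (hb : b ∈ jointSet A) (ω : Ω) : sqDist ρ μ b t ω ≤ (2 * R) ^ 2 := by
  refine pow_le_pow_left₀ (norm_nonneg _) ?_ 2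
  have h1 := hG.norm_le _ (hrun.state_mem_jointSet hG ht hρ0 hρ1 ω)
  have h2 : (1 - ρ t) • b ∈ jointSet A := fun i =>
    shrink_subset (hG.convex i) (hG.zero_mem i) hρ0 hρ1 (Set.smul_mem_smul_set (hb i))
  have h3 := hG.norm_le _ h2
  exact (norm_sub_le _ _).trans (by linarith)

lemma IsOnePointRun.integrable_sqDist [IsProbabilityMeasure P]
    (hrun : IsOnePointRun P A J γ σ ρ μ₁ μ ξ a)
    (hG : GameBounds A J r L B R) {t : ℕ} (ht : 1 ≤ t) (hρ0 : 0 ≤ ρ t) (hρ1 : ρ t ≤ 1)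
    {b : Joint N d} (hb : b ∈ jointSet A) : Integrable (sqDist ρ μ b t) P :=
  Integrable.of_bound ((measurable_sqDist_history ρ μ ξ b t).mono
    (hrun.history_le hG _) le_rfl).aestronglyMeasurable ((2 * R) ^ 2)
    (ae_of_all _ fun ω => by
      rw [Real.norm_of_nonneg (sqDist_nonneg ρ μ b t ω)]
      exact hrun.sqDist_le hG ht hρ0 hρ1 hb ω)

/-- The basic recursion, on an event of the past. -/
lemma IsOnePointRun.exists_recursion [IsProbabilityMeasure P] {ν c ε : ℝ} (hν : 0 < ν)
    (hc : 0 < c) (hε : 0 < ε) (hε' : ε < 1 / 4)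
    (hγ : γ = fun t : ℕ => 4 / (ν * (t : ℝ))) (hσ : σ = fun t : ℕ => c / (t : ℝ) ^ (1 / 4 : ℝ))
    (hρ : ρ = fun t : ℕ => 1 / (t : ℝ) ^ (1 / 4 - ε))
    (hrun : IsOnePointRun P A J γ σ ρ μ₁ μ ξ a) (hG : GameBounds A J r L B R)
    (hM : StronglyMonotone ν (pseudoGradient J)) {b : Joint N d} (hb : b ∈ jointSet A)
    (hvi : ∀ y ∈ jointSet A, 0 ≤ ⟪pseudoGradient J b, y - b⟫) :
    ∃ C : ℝ, 0 ≤ C ∧ ∀ n : ℕ, 3 ≤ n → ∀ S, MeasurableSet[history μ ξ (n + 1)] S →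
      ∫ ω in S, sqDist ρ μ b (n + 1) ω ∂P ≤
        (1 - 2 / ((n : ℝ) + 1)) * ∫ ω in S, sqDist ρ μ b n ω ∂P
          + C * ((n : ℝ) + 1) ^ (-(1 + 2 * (1 / 4 - ε))) * P.real S := by
  -- With this `k`, `(t ^ (-ε)) ^ k ≤ t ^ (-1/4)`, so the projection error is no larger than the
  -- order of the smoothing error `σ_t`.
  obtain ⟨k, hk⟩ := exists_nat_ge (1 / 4 / ε)
  have hk' : 1 / 4 ≤ ε * k := by rwa [div_le_iff₀' hε] at hk
  have hR : 0 ≤ R := (norm_nonneg _).trans (hG.norm_le b hb)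
  set Q := L * R + N * (L * c * gaussMoment N d 3
    + 2 * B * (c / r) ^ k * gaussMoment N d (k + 2)) with hQ
  set C := 4 * Q ^ 2 / ν ^ 2 + 16 * (B * R) / ν
      + 16 * (B ^ 2 * gaussMoment N d 2) / (ν ^ 2 * c ^ 2) + 8 * R ^ 2 with hC
  have hB := hG.B_nonneg
  have hm2 := gaussMoment_nonneg (N := N) (d := d) 2
  refine ⟨C, by positivity, fun n hn S hS => ?_⟩
  have hn3 : (3 : ℝ) ≤ n := by exact_mod_cast hn
  have hn1 : 1 ≤ n := by omega
  have hp0 : 0 < 1 / 4 - ε := by linarith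
  have hρ0 : ∀ t : ℕ, 1 ≤ t → 0 < ρ t := fun t ht => by
    have : (0 : ℝ) < t := by exact_mod_cast ht
    rw [hρ]; positivity
  have hρ1 : ∀ t : ℕ, 1 ≤ t → ρ t ≤ 1 := fun t ht => by
    have : (1 : ℝ) ≤ t := by exact_mod_cast ht
    rw [hρ]
    exact div_le_one_of_le₀ (Real.one_le_rpow this hp0.le) (by positivity)
  have hσ0 : 0 < σ (n + 1) := by rw [hσ]; positivity
  have hγ0 : 0 ≤ γ (n + 1) := by rw [hγ]; positivity
  have hS' : MeasurableSet S := hrun.history_le hG _ S hS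
  set bn := C * ((n : ℝ) + 1) ^ (-(1 + 2 * (1 / 4 - ε))) with hbn
  have hbn0 : 0 ≤ bn := by positivity
  have hcoef : 0 ≤ 1 - 2 / ((n : ℝ) + 1) := by
    rw [sub_nonneg, div_le_one (by positivity)]; linarith
  have hI0 := hrun.integrable_sqDist hG hn1 (hρ0 n hn1).le (hρ1 n hn1) hb
  have hI1 := hrun.integrable_sqDist hG (Nat.le_add_left 1 n) (hρ0 (n + 1) (by omega)).le
    (hρ1 (n + 1) (by omega)) hb
  have hIG : Integrable (fun ω => (1 - 2 / ((n : ℝ) + 1)) * sqDist ρ μ b n ω + bn) P :=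
    (hI0.const_mul _).add (integrable_const _)
  have hG0 : ∀ ω, 0 ≤ (1 - 2 / ((n : ℝ) + 1)) * sqDist ρ μ b n ω + bn := fun ω =>
    add_nonneg (mul_nonneg hcoef (sqDist_nonneg ρ μ b n ω)) hbn0
  have hpt : ∀ ω, ∫⁻ z, ENNReal.ofReal (‖μ (n + 1) ω - γ (n + 1) • gradEstimate A J (σ (n + 1))
      (μ (n + 1) ω) (μ (n + 1) ω + σ (n + 1) • z) - (1 - ρ (n + 1)) • b‖ ^ 2)
        ∂(stdGaussian (Joint N d)) ≤
      ENNReal.ofReal ((1 - 2 / ((n : ℝ) + 1)) * sqDist ρ μ b n ω + bn) := by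
    intro ω
    have hm := fun i => hrun.state_mem hn1 ω i
    refine (hG.integral_step_le (hρ0 n hn1) (hρ1 n hn1) hσ0 hm k hγ0 _).trans
      (ENNReal.ofReal_le_ofReal ?_)
    have hρρ : ρ (n + 1) ≤ ρ n := by
      rw [hρ]
      simp only
      gcongr
      omega
    have hdrift := hG.drift_ge hM hb hvi (hρ0 (n + 1) (by omega)).le hρρ (hρ1 n hn1) hm
    have herr := error_terms_le (y := (n : ℝ)) (R := R) N k hν hc hε hε' hG.r_pos hG.L_nonneg hB
      hR hm2 (gaussMoment_nonneg (N := N) (d := d) 3) (gaussMoment_nonneg (N := N) (d := d) (k + 2))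
      hk' (by linarith) (σ := σ (n + 1)) (ρ := ρ (n + 1)) (ρ' := ρ n)
      (by rw [hσ]; push_cast; rfl) (by rw [hρ]; push_cast; rfl) (by rw [hρ])
    have hVW : ‖μ (n + 1) ω - (1 - ρ (n + 1)) • b‖ ≤
        ‖μ (n + 1) ω - (1 - ρ n) • b‖ + R * (ρ n - ρ (n + 1)) := by
      have h1 : μ (n + 1) ω - (1 - ρ (n + 1)) • b =
          (μ (n + 1) ω - (1 - ρ n) • b) - (ρ n - ρ (n + 1)) • b := by module
      rw [h1]
      refine (norm_sub_le _ _).trans ?_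
      rw [norm_smul, Real.norm_of_nonneg (sub_nonneg.2 hρρ), mul_comm R]
      have := hG.norm_le b hb
      have := sub_nonneg.2 hρρ
      gcongr
    have hγn : γ (n + 1) = 4 / (ν * ((n : ℝ) + 1)) := by rw [hγ]; push_cast; rfl
    rw [hγn]
    refine (recursion_arith hν (by linarith) (norm_nonneg _) hVW hdrift rfl).trans ?_
    exact add_le_add le_rfl herr
  let F : Joint N d × Joint N d → ENNReal := fun q => ENNReal.ofReal
    (‖q.1 - γ (n + 1) • gradEstimate A J (σ (n + 1)) q.1 q.2 - (1 - ρ (n + 1)) • b‖ ^ 2)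
  have hmeas : Measurable F := by
    have := hG.continuous_gradEstimate (σ (n + 1))
    have hcont := (((continuous_fst.sub (this.const_smul (γ (n + 1)))).sub
      (continuous_const (y := (1 - ρ (n + 1)) • b))).norm).pow 2
    exact hcont.measurable.ennreal_ofReal
  have hle : ∫⁻ ω in S, ENNReal.ofReal (sqDist ρ μ b (n + 1) ω) ∂P ≤
      ∫⁻ ω in S, ENNReal.ofReal ((1 - 2 / ((n : ℝ) + 1)) * sqDist ρ μ b n ω + bn) ∂P := by
    refine (lintegral_mono fun ω => ENNReal.ofReal_le_ofReal (pow_le_pow_left₀ (norm_nonneg _)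
      (hrun.norm_state_sub_le hG.admissible (Nat.le_add_left 1 n) hb ω) 2)).trans ?_
    have hset := hrun.setLIntegral_eq hG (Nat.le_add_left 1 n) hσ0.le hS hmeas
    simp only [F] at hset
    rw [hset]
    exact lintegral_mono hpt
  rw [← ofReal_integral_eq_lintegral_ofReal hI1.integrableOn
      (ae_of_all _ fun ω => sqDist_nonneg ρ μ b (n + 1) ω),
    ← ofReal_integral_eq_lintegral_ofReal hIG.integrableOn (ae_of_all _ hG0),
    ENNReal.ofReal_le_ofReal_iff (integral_nonneg hG0)] at hle
  refine hle.trans (le_of_eq ?_)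
  rw [integral_add (hI0.const_mul _).integrableOn (integrable_const _).integrableOn,
    integral_const_mul, setIntegral_const, smul_eq_mul, mul_comm (P.real S)]

end

/-! ### Convergence -/

lemma exists_gameBounds {A : Fin N → Set (Action d)} {J : Fin N → Joint N d → ℝ}
    (hconv : ∀ i, Convex ℝ (A i)) (hJ : ∀ i, ContDiff ℝ 1 (J i)) (hcomp : ∀ i, IsCompact (A i))
    (hzero : ∀ i, (0 : Action d) ∈ interior (A i))
    (hM : (Differentiable ℝ (pseudoGradient J) ∧ Differentiable ℝ (fderiv ℝ (pseudoGradient J))) ∨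
      (Differentiable ℝ (pseudoGradient J) ∧ ∃ K : NNReal, LipschitzWith K (pseudoGradient J))) :
    ∃ r L B R, GameBounds A J r L B R := by
  have hK := isCompact_jointSet hcomp
  obtain ⟨L, hL0, hL⟩ := exists_lipschitz_on hK (convex_jointSet hconv) hM
  obtain ⟨R, hR⟩ := hK.exists_bound_of_continuousOn continuous_id.continuousOn
  have hopen : IsOpen (⋂ i, interior (A i)) := isOpen_iInter_of_finite fun i => isOpen_interior
  obtain ⟨r, hr0, hr⟩ := Metric.isOpen_iff.1 hopen 0 (Set.mem_iInter.2 hzero)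
  choose b hb using fun i => hK.exists_bound_of_continuousOn (hJ i).continuous.continuousOn
  have h0 : (0 : Joint N d) ∈ jointSet A := fun i => interior_subset (hzero i)
  have hR0 : 0 ≤ R := (norm_nonneg _).trans (hR 0 h0)
  -- The gradient bound comes from the value at the feasible point `0` and the Lipschitz bound; it
  -- is added to the cost bounds so that a single `B` serves for both.
  set G := ‖pseudoGradient J 0‖ + L * R
  have hG0 : 0 ≤ G := by positivity
  have hsum : 0 ≤ ∑ i, |b i| := Finset.sum_nonneg fun i _ => abs_nonneg _
  refine ⟨r, L, ∑ i, |b i| + G, R, hcomp, hconv, hJ, hr0, fun i => ?_, hL0, hL, by positivity,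
    fun i x hx => ?_, fun x hx => ?_, hR⟩
  · exact hr.trans ((Set.iInter_subset _ i).trans interior_subset)
  · have h1 := (hb i x hx).trans (le_abs_self _)
    have h2 := Finset.single_le_sum (f := fun i => |b i|) (fun i _ => abs_nonneg _)
      (Finset.mem_univ i)
    rw [Real.norm_eq_abs] at h1
    linarith
  · have h1 := hL x hx 0 h0
    have h2 : ‖pseudoGradient J x‖ ≤ ‖pseudoGradient J x - pseudoGradient J 0‖
        + ‖pseudoGradient J 0‖ := by
      simpa using norm_add_le (pseudoGradient J x - pseudoGradient J 0) (pseudoGradient J 0)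
    have h3 : L * ‖x - 0‖ ≤ L * R := by
      rw [sub_zero]
      exact mul_le_mul_of_nonneg_left (hR x hx) hL0
    linarith

lemma norm_add_sq_le_two {E : Type*} [NormedAddCommGroup E] (x y : E) :
    ‖x + y‖ ^ 2 ≤ 2 * ‖x‖ ^ 2 + 2 * ‖y‖ ^ 2 := by
  have h := pow_le_pow_left₀ (norm_nonneg _) (norm_add_le x y) 2
  nlinarith [sq_nonneg (‖x‖ - ‖y‖)]

lemma norm_sub_sq_le_sqDist {Ω : Type*} (ρ : ℕ → ℝ) (μ : ℕ → Ω → Joint N d) (b : Joint N d)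
    (n : ℕ) (ω : Ω) :
    ‖μ (n + 1) ω - b‖ ^ 2 ≤ 2 * sqDist ρ μ b n ω + 2 * (ρ n ^ 2 * ‖b‖ ^ 2) := by
  have e : μ (n + 1) ω - b = (μ (n + 1) ω - (1 - ρ n) • b) + (-ρ n) • b := by module
  have h := norm_add_sq_le_two (μ (n + 1) ω - (1 - ρ n) • b) ((-ρ n) • b)
  rw [← e, norm_smul (-ρ n), mul_pow, Real.norm_eq_abs, sq_abs, neg_sq] at h
  exact h

/-- Mean-square convergence implies convergence in measure. -/
lemma tendstoInMeasure_of_lintegral_sq_le {Ω E : Type*} [MeasurableSpace Ω] {P : Measure Ω}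
    [NormedAddCommGroup E] {f : ℕ → Ω → E} {g : Ω → E} {u : ℕ → ℝ}
    (hu : Tendsto u atTop (𝓝 0))
    (h : ∀ᶠ n in atTop, AEMeasurable (fun ω => ENNReal.ofReal (‖f n ω - g ω‖ ^ 2)) P ∧
      ∫⁻ ω, ENNReal.ofReal (‖f n ω - g ω‖ ^ 2) ∂P ≤ ENNReal.ofReal (u n)) :
    TendstoInMeasure P f atTop g := by
  rw [tendstoInMeasure_iff_norm]
  intro δ hδ
  have hlim : Tendsto (fun n => ENNReal.ofReal (u n) / ENNReal.ofReal (δ ^ 2)) atTop (𝓝 0) := by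
    have h1 := (ENNReal.continuous_ofReal.tendsto 0).comp hu
    have h2 := ENNReal.Tendsto.div_const h1 (b := ENNReal.ofReal (δ ^ 2))
      (Or.inr (by simpa using hδ.ne'))
    simpa [Function.comp_def] using h2
  refine tendsto_of_tendsto_of_tendsto_of_le_of_le' tendsto_const_nhds hlim
    (Eventually.of_forall fun n => zero_le) ?_
  filter_upwards [h] with n hn
  have hδ2 : ENNReal.ofReal (δ ^ 2) ≠ 0 := by simpa using hδ.ne'
  refine (measure_mono fun ω hω => ?_).trans ((meas_ge_le_lintegral_div hn.1 hδ2
    ENNReal.ofReal_ne_top).trans (ENNReal.div_le_div_right hn.2 _))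
  exact ENNReal.ofReal_le_ofReal (pow_le_pow_left₀ hδ.le hω 2)

section
variable {A : Fin N → Set (Action d)} {J : Fin N → Joint N d → ℝ} {r L B R : ℝ}
  {Ω : Type*} [mΩ : MeasurableSpace Ω] {P : Measure Ω} [IsProbabilityMeasure P]
  {γ σ ρ : ℕ → ℝ} {μ₁ : Joint N d} {μ ξ a : ℕ → Ω → Joint N d}

/-- The mean-square deviation of the sample from the state. -/
lemma IsOnePointRun.lintegral_sample_sub_state (hrun : IsOnePointRun P A J γ σ ρ μ₁ μ ξ a)
    (hG : GameBounds A J r L B R) {t : ℕ} (ht : 1 ≤ t) (hσ : 0 ≤ σ t) :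
    ∫⁻ ω, ENNReal.ofReal (‖ξ t ω - μ t ω‖ ^ 2) ∂P =
      ENNReal.ofReal (σ t ^ 2 * gaussMoment N d 2) := by
  have hf : Measurable fun q : Joint N d × Joint N d => ENNReal.ofReal (‖q.2 - q.1‖ ^ 2) := by
    fun_prop
  have h := hrun.setLIntegral_eq hG ht hσ (S := Set.univ) MeasurableSet.univ hf
  simp only [Measure.restrict_univ, add_sub_cancel_left, lintegral_const, measure_univ, mul_one,
    norm_smul, mul_pow, Real.norm_eq_abs, sq_abs] at h
  rw [h, gaussMoment, ← integral_const_mul]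
  exact (ofReal_integral_eq_lintegral_ofReal
    ((integrable_norm_pow_stdGaussian (E := Joint N d) 2).const_mul _)
    (ae_of_all _ fun z => by positivity)).symm

lemma IsOnePointRun.integrable_sq (hrun : IsOnePointRun P A J γ σ ρ μ₁ μ ξ a)
    (hG : GameBounds A J r L B R) (hρ : ∀ t, 1 ≤ t → 0 ≤ ρ t ∧ ρ t ≤ 1) {b : Joint N d}
    (hb : b ∈ jointSet A) {t : ℕ} (ht : 1 ≤ t) : Integrable (fun ω => ‖μ t ω - b‖ ^ 2) P := by
  rcases Nat.exists_eq_add_of_le' ht with ⟨n, rfl⟩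
  rcases Nat.eq_zero_or_pos n with rfl | hn
  -- The initial state may lie outside the action sets, but it is deterministic.
  · simp only [zero_add, hrun.init]
    exact integrable_const _
  · refine Integrable.of_bound (C := (2 * R) ^ 2) ?_ (ae_of_all _ fun ω => ?_)
    · have := hrun.measurable_state hG ht
      exact ((this.sub_const b).norm.pow_const 2).aestronglyMeasurable
    · rw [Real.norm_of_nonneg (sq_nonneg _)]
      refine pow_le_pow_left₀ (norm_nonneg _) ((norm_sub_le _ _).trans ?_) 2
      have h1 := hG.norm_le _ (hrun.state_mem_jointSet hG hn (hρ n hn).1 (hρ n hn).2 ω)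
      have h2 := hG.norm_le b hb
      linarith

end

end PayoffLearning

end

open PayoffLearning in
theorem theorem2 {N d : ℕ}
    (A : Fin N → Set (PayoffLearning.Action d)) (J : Fin N → PayoffLearning.Joint N d → ℝ)
    -- convex game
    (hA_convex : ∀ i, Convex ℝ (A i)) (hA_closed : ∀ i, IsClosed (A i))
    (hJ_smooth : ∀ i, ContDiff ℝ 1 (J i))
    (hJ_convex : ∀ i x, ConvexOn ℝ Set.univ
      (fun y : PayoffLearning.Action d => J i (PayoffLearning.deviate x i y)))
    -- compact action sets, with the origin (the centre of the shrinking) as an interior point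
    (hA_compact : ∀ i, IsCompact (A i))
    (hA_zero : ∀ i, (0 : PayoffLearning.Action d) ∈ interior (A i))
    -- strongly monotone pseudo-gradient
    (ν : ℝ) (hν : 0 < ν)
    (hM : PayoffLearning.StronglyMonotone ν (PayoffLearning.pseudoGradient J))
    -- growth at infinity
    (hJ_growth : ∀ i, ∃ α : ℝ, α < 2 ∧
      J i =O[Bornology.cobounded (PayoffLearning.Joint N d)] fun x => Real.exp (‖x‖ ^ α))
    -- smoothness of the pseudo-gradient
    (hM_smooth :
      (Differentiable ℝ (PayoffLearning.pseudoGradient J) ∧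
        Differentiable ℝ (fderiv ℝ (PayoffLearning.pseudoGradient J))) ∨
      (Differentiable ℝ (PayoffLearning.pseudoGradient J) ∧
        ∃ K : NNReal, LipschitzWith K (PayoffLearning.pseudoGradient J)))
    -- the algorithm and its parameters
    (c ε : ℝ) (hc : 0 < c) (hε : 0 < ε) (hε' : ε < 1 / 4)
    {Ω : Type*} [MeasurableSpace Ω] (P : Measure Ω) [IsProbabilityMeasure P]
    (μ₁ : PayoffLearning.Joint N d) (μ ξ a : ℕ → Ω → PayoffLearning.Joint N d)
    (hrun : PayoffLearning.IsOnePointRun P A J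
      (fun t => 4 / (ν * (t : ℝ)))
      (fun t => c / (t : ℝ) ^ (1 / 4 : ℝ))
      (fun t => 1 / (t : ℝ) ^ (1 / 4 - ε))
      μ₁ μ ξ a) :
    ∃ aStar : PayoffLearning.Joint N d,
      PayoffLearning.IsNash A J aStar ∧
      (∀ b, PayoffLearning.IsNash A J b → b = aStar) ∧
      (∀ᵐ ω ∂P, Tendsto (fun t => μ t ω) atTop (𝓝 aStar)) ∧
      TendstoInMeasure P ξ atTop (fun _ => aStar) ∧
      (∀ t, 1 ≤ t → Integrable (fun ω => ‖μ t ω - aStar‖ ^ 2) P) ∧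
      (fun t : ℕ => ∫ ω, ‖μ t ω - aStar‖ ^ 2 ∂P) =O[atTop]
        (fun t : ℕ => 1 / (t : ℝ) ^ (1 / 2 - 2 * ε)) := by
  obtain ⟨r, L, B, R, hG⟩ := exists_gameBounds hA_convex hJ_smooth hA_compact hA_zero hM_smooth
  obtain ⟨b, hb, huniq, hvi⟩ := exists_unique_isNash hG.admissible hJ_smooth hJ_convex hν hM
    hG.lipschitz
  have hbA : b ∈ jointSet A := hb.1
  obtain ⟨C, hC0, hrec⟩ := hrun.exists_recursion hν hc hε hε' rfl rfl rfl hG hM hbA hvi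
  set ρ : ℕ → ℝ := fun t => 1 / (t : ℝ) ^ (1 / 4 - ε) with hρdef
  set σ : ℕ → ℝ := fun t => c / (t : ℝ) ^ (1 / 4 : ℝ) with hσdef
  set p := 1 / 4 - ε with hp
  have hp0 : 0 < p := by rw [hp]; linarith
  have hp4 : p ≤ 1 / 4 := by rw [hp]; linarith
  have hρ : ∀ t, 1 ≤ t → 0 ≤ ρ t ∧ ρ t ≤ 1 := fun t ht => by
    have : (1 : ℝ) ≤ t := by exact_mod_cast ht
    exact ⟨by positivity, div_le_one_of_le₀ (Real.one_le_rpow this hp0.le) (by positivity)⟩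
  have hρlim : Tendsto ρ atTop (𝓝 0) := by
    have := (tendsto_rpow_neg_atTop hp0).comp tendsto_natCast_atTop_atTop
    refine this.congr fun t => ?_
    simp only [hρdef, Function.comp_apply]
    rw [Real.rpow_neg (by positivity), one_div]
  -- mean-square rate
  obtain ⟨K, hK⟩ := le_rpow_of_recursion (e := fun n => ∫ ω, sqDist ρ μ b n ω ∂P) (q := 2 * p)
    (C := C) (n₀ := 3) (by linarith) (by norm_num) fun n hn => by
      have := hrec n hn Set.univ MeasurableSet.univ
      simpa using this
  have hEbound : ∀ n : ℕ, 3 ≤ n → ∫ ω, ‖μ (n + 1) ω - b‖ ^ 2 ∂P ≤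
      (2 * K + 18 * ‖b‖ ^ 2) * ((n : ℝ) + 1) ^ (-(2 * p)) := by
    intro n hn
    have hn1 : 1 ≤ n := by omega
    have hI := hrun.integrable_sqDist hG hn1 (hρ n hn1).1 (hρ n hn1).2 hbA
    have h1 : ∫ ω, ‖μ (n + 1) ω - b‖ ^ 2 ∂P ≤
        2 * ∫ ω, sqDist ρ μ b n ω ∂P + 2 * (ρ n ^ 2 * ‖b‖ ^ 2) := by
      have h2 := integral_mono (hrun.integrable_sq hG hρ hbA (Nat.le_add_left 1 n))
        ((hI.const_mul 2).add (integrable_const (2 * (ρ n ^ 2 * ‖b‖ ^ 2))))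
        (norm_sub_sq_le_sqDist ρ μ b n)
      rw [integral_add' (hI.const_mul 2) (integrable_const _), integral_const_mul] at h2
      simpa using h2
    have hn1' : (1 : ℝ) ≤ n := by exact_mod_cast hn1
    have hx0 : (0 : ℝ) < (n : ℝ) + 1 := by linarith
    -- Write `ρ n` as its increment plus `ρ (n + 1)`, which contribute `2` and `1`. Squaring gives
    -- the `9`, and the doubling in `h1` the `18`.
    have h3 : ρ n ≤ 3 * ((n : ℝ) + 1) ^ (-p) := by
      have h4 := inv_rpow_sub_inv_rpow_le (p := p) (y := (n : ℝ)) (by linarith) hn1'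
      have h5 : 1 / ((n : ℝ) + 1) ^ p = ((n : ℝ) + 1) ^ (-p) := by
        rw [Real.rpow_neg hx0.le, one_div]
      have h6 : 2 * ((n : ℝ) + 1) ^ (-p) / ((n : ℝ) + 1) ≤ 2 * ((n : ℝ) + 1) ^ (-p) :=
        div_le_self (by positivity) (by linarith)
      have h7 : ρ n = 1 / (n : ℝ) ^ p := rfl
      linarith
    have h4 : ρ n ^ 2 ≤ 9 * ((n : ℝ) + 1) ^ (-(2 * p)) := by
      refine (pow_le_pow_left₀ (hρ n hn1).1 h3 2).trans (le_of_eq ?_)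
      rw [mul_pow, ← Real.rpow_natCast (((n : ℝ) + 1) ^ (-p)), ← Real.rpow_mul hx0.le]
      norm_num
      congr 1
      ring
    have h5 := hK n hn
    have h6 := mul_le_mul_of_nonneg_right h4 (sq_nonneg ‖b‖)
    linarith
  have hrpow0 : Tendsto (fun n : ℕ => ((n : ℝ) + 1) ^ (-(2 * p))) atTop (𝓝 0) :=
    (tendsto_rpow_neg_atTop (by linarith : 0 < 2 * p)).comp
      (tendsto_atTop_add_const_right _ _ tendsto_natCast_atTop_atTop)
  refine ⟨b, hb, huniq, ?_, ?_, fun t ht => hrun.integrable_sq hG hρ hbA ht, ?_⟩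
  · -- almost sure convergence of the states
    -- The shift by `3` starts where the recursion becomes valid; the extra `1` is there because
    -- `sqDist` at index `n` involves the state at time `n + 1`.
    let ℱ : Filtration ℕ ‹MeasurableSpace Ω› :=
      ⟨fun n => history μ ξ (n + 3 + 1), fun m n hmn => history_mono μ ξ (by omega),
        fun n => hrun.history_le hG _⟩
    have hsummable : Summable fun n : ℕ => C * (((n + 3 : ℕ) : ℝ) + 1) ^ (-(1 + 2 * p)) := by
      have h1 : Summable fun n : ℕ => (n : ℝ) ^ (-(1 + 2 * p)) :=
        Real.summable_nat_rpow.2 (by linarith)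
      have h2 := ((summable_nat_add_iff 4).2 h1).mul_left C
      refine h2.congr fun n => ?_
      push_cast
      congr 2
      ring
    have has := ae_tendsto_zero_of_almost_supermartingale (P := P) (ℱ := ℱ)
      (D := fun n => sqDist ρ μ b (n + 3)) (K := (2 * R) ^ 2)
      (fun n => (measurable_sqDist_history ρ μ ξ b (n + 3)).stronglyMeasurable)
      (fun n ω => sqDist_nonneg ρ μ b _ ω)
      (fun n ω => hrun.sqDist_le hG (by omega) (hρ _ (by omega)).1 (hρ _ (by omega)).2 hbA ω)
      (fun n => by positivity) hsummable ?_ ?_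
    · filter_upwards [has] with ω hω
      have h1 : Tendsto (fun n => sqDist ρ μ b n ω) atTop (𝓝 0) :=
        (tendsto_add_atTop_iff_nat 3).1 hω
      have h2 : Tendsto (fun n => 2 * sqDist ρ μ b n ω + 2 * (ρ n ^ 2 * ‖b‖ ^ 2)) atTop (𝓝 0) := by
        have := (h1.const_mul 2).add (((hρlim.pow 2).mul_const (‖b‖ ^ 2)).const_mul 2)
        simpa using this
      have h3 : Tendsto (fun n => ‖μ (n + 1) ω - b‖ ^ 2) atTop (𝓝 0) :=
        squeeze_zero (fun n => sq_nonneg _) (fun n => norm_sub_sq_le_sqDist ρ μ b n ω) h2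
      have h4 : Tendsto (fun n => ‖μ (n + 1) ω - b‖) atTop (𝓝 0) := by
        have := h3.sqrt
        simpa [Real.sqrt_sq] using this
      exact (tendsto_add_atTop_iff_nat 1).1 (tendsto_iff_norm_sub_tendsto_zero.2 h4)
    · intro n S hS
      refine (hrec (n + 3) (by omega) S hS).trans (add_le_add ?_ le_rfl)
      refine mul_le_of_le_one_left (integral_nonneg fun ω => sqDist_nonneg ρ μ b _ ω) ?_
      have : (0 : ℝ) ≤ 2 / (((n + 3 : ℕ) : ℝ) + 1) := by positivity
      linarith
    · refine (tendsto_add_atTop_iff_nat (f := fun n => ∫ ω, sqDist ρ μ b n ω ∂P) 3).2 ?_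
      refine squeeze_zero' (Eventually.of_forall fun n => integral_nonneg fun ω =>
        sqDist_nonneg ρ μ b n ω) ((eventually_ge_atTop 3).mono hK) ?_
      simpa using hrpow0.const_mul K
  · -- convergence in probability of the samples
    refine tendstoInMeasure_of_lintegral_sq_le
      -- The sample error is split at the state: the noise has mean square `σ_t ^ 2` times the
      -- Gaussian moment, and the state error is already known to vanish.
      (u := fun t => 2 * (σ t ^ 2 * gaussMoment N d 2) + 2 * ∫ ω, ‖μ t ω - b‖ ^ 2 ∂P) ?_ ?_
    · have h1 : Tendsto σ atTop (𝓝 0) := by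
        have := ((tendsto_rpow_neg_atTop (by norm_num : (0 : ℝ) < 1 / 4)).comp
          tendsto_natCast_atTop_atTop).const_mul c
        rw [mul_zero] at this
        refine this.congr fun t => ?_
        simp only [hσdef, Function.comp_apply]
        rw [Real.rpow_neg (by positivity), ← div_eq_mul_inv]
      have h2 : Tendsto (fun t => ∫ ω, ‖μ t ω - b‖ ^ 2 ∂P) atTop (𝓝 0) := by
        refine (tendsto_add_atTop_iff_nat 1).1 ?_
        refine squeeze_zero' (Eventually.of_forall fun n => integral_nonneg fun ω => sq_nonneg _)
          ((eventually_ge_atTop 3).mono hEbound) ?_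
        simpa using hrpow0.const_mul (2 * K + 18 * ‖b‖ ^ 2)
      have := (((h1.pow 2).mul_const (gaussMoment N d 2)).const_mul 2).add (h2.const_mul 2)
      simpa using this
    · filter_upwards [eventually_ge_atTop 1] with t ht
      have hσt : 0 ≤ σ t := by positivity
      have hμm := hrun.measurable_state hG ht
      have hξm := hrun.measurable_sample t ht
      have hm0 := gaussMoment_nonneg (N := N) (d := d) 2
      refine ⟨by fun_prop, ?_⟩
      have h1 : ∫⁻ ω, ENNReal.ofReal (‖ξ t ω - b‖ ^ 2) ∂P ≤
          ∫⁻ ω, (2 * ENNReal.ofReal (‖ξ t ω - μ t ω‖ ^ 2)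
            + 2 * ENNReal.ofReal (‖μ t ω - b‖ ^ 2)) ∂P := by
        refine lintegral_mono fun ω => ?_
        have h2 := norm_add_sq_le_two (ξ t ω - μ t ω) (μ t ω - b)
        rw [sub_add_sub_cancel] at h2
        refine (ENNReal.ofReal_le_ofReal h2).trans (le_of_eq ?_)
        rw [ENNReal.ofReal_add (by positivity) (by positivity), ENNReal.ofReal_mul (by norm_num),
          ENNReal.ofReal_mul (by norm_num), ENNReal.ofReal_ofNat]
      refine h1.trans (le_of_eq ?_)
      rw [lintegral_add_left (by fun_prop), lintegral_const_mul _ (by fun_prop),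
        lintegral_const_mul _ (by fun_prop), hrun.lintegral_sample_sub_state hG ht hσt,
        ← ofReal_integral_eq_lintegral_ofReal (hrun.integrable_sq hG hρ hbA ht)
          (ae_of_all _ fun ω => sq_nonneg _),
        ENNReal.ofReal_add (by positivity)
          (mul_nonneg zero_le_two (integral_nonneg fun ω => sq_nonneg _)),
        ENNReal.ofReal_mul (p := 2) (by norm_num), ENNReal.ofReal_mul (p := 2) (by norm_num),
        ENNReal.ofReal_ofNat]
  · -- the rate
    refine Asymptotics.IsBigO.of_bound (2 * K + 18 * ‖b‖ ^ 2) ?_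
    filter_upwards [eventually_ge_atTop 4] with t ht
    obtain ⟨n, rfl⟩ := Nat.exists_eq_add_of_le' (show 1 ≤ t by omega)
    have h1 := hEbound n (by omega)
    have hx0 : (0 : ℝ) < (n : ℝ) + 1 := by positivity
    rw [Real.norm_of_nonneg (integral_nonneg fun ω => sq_nonneg _),
      Real.norm_of_nonneg (by positivity)]
    have e : (1 : ℝ) / ((n + 1 : ℕ) : ℝ) ^ (1 / 2 - 2 * ε) = ((n : ℝ) + 1) ^ (-(2 * p)) := by
      rw [Real.rpow_neg hx0.le, one_div, hp]
      push_cast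
      congr 2
      ring
    rw [e]
    exact h1
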